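/- Let $\widetilde M$ be a smooth 5-manifold with a smooth Lorentzian metric $\tilde g$ of signature $(+,-,-,-,-)$ and let $M$ be a smooth 6-manifold with a smooth negative definite metric $g$ (a Riemannian metric in the "mostly minus" convention). Let $X^{1,10}=\widetilde M\times M$ carry the product metric $h=\tilde g+g$. $\mathrm{Ric}$ denotes the Ricci tensor of the Levi-Civita connection, $\mathrm{Ric}(Y,Z)=\mathrm{tr}(W\mapsto R(W,Y)Z)$ with $R(W,Y)Z=\nabla_W\nabla_YZ-\nabla_Y\nabla_WZ-\nabla_{[W,Y]}Z$. For $k$-forms put $$\langle\omega,\eta\rangle_h=\frac1{k!}\sum\omega_{i_1\dots i_k}\eta_{j_1\dots j_k}h^{i_1j_1}\cdots h^{i_kj_k},\qquad \|\omega\|_h^2=\langle\omega,\omega\rangle_h,$$ and similarly for $\tilde g$ and $g$; $\lrcorner$ is the interior product into the first argument, and forms on the factors are pulled back to $X^{1,10}$ without change of notation. A 4-form $F$ satisfies the supergravity Einstein equation if, for all vector fields $U,V$ on $X^{1,10}$, $$\mathrm{Ric}_h(U,V)=-\tfrac12\langle U\lrcorner F,V\lrcorner F\rangle_h+\tfrac16h(U,V)\|F\|_h^2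 .$$ Let $\tilde\alpha\in\Omega^4(\widetilde M)$, $\tilde\beta\in\Omega^3(\widetilde M)$, $\tilde\gamma\in\Omega^2(\widetilde M)$, $\tilde\varpi\in\Omega^1(\widetilde M)$, $\tilde\psi\in C^\infty(\widetilde M)$, $\varphi\in C^\infty(M)$, $\nu\in\Omega^1(M)$, $\delta\in\Omega^2(M)$, $\epsilon\in\Omega^3(M)$, $\theta\in\Omega^4(M)$. Throughout, $X,Y$ are tangent to $M$ and $\tilde X,\tilde Y$ are tangent to $\widetilde M$. For a form $\omega$ on $M$ and a form $\tilde\omega$ on $\widetilde M$ write $$S_\omega(X,Y)=\tfrac16\|\omega\|_g^2\,g(X,Y)-\tfrac12\langle X\lrcorner\omega,Y\lrcorner\omega\rangle_g,\qquad \tilde S_{\tilde\omega}(\tilde X,\tilde Y)=\tfrac16\|\tilde\omega\|_{\tilde g}^2\,\tilde g(\tilde X,\tilde Y)-\tfrac12\langle \tilde X\lrcorner\tilde\omega,\tilde Y\lrcorner\tilde\omega\rangle_{\tilde g},$$ where for 1-forms $\langle X\lrcorner\nu,Y\lrcorner\nu\rangle=\nu(X)\nu(Y)$. **Theorem.** One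 has $\mathrm{Ric}_h(X,Y)=\mathrm{Ric}_g(X,Y)$, $\mathrm{Ric}_h(\tilde X,\tilde Y)=\mathrm{Ric}_{\tilde g}(\tilde X,\tilde Y)$ and $\mathrm{Ric}_h(X,\tilde Y)=0$. The 4-form $$F=\varphi\tilde\alpha+\tilde\beta\wedge\nu+\tilde\gamma\wedge\delta+\tilde\varpi\wedge\epsilon+\tilde\psi\theta$$ satisfies the supergravity Einstein equation if and only if the following three equations hold at all points and for all $X,Y,\tilde X,\tilde Y$: $$\mathrm{Ric}_h(X,Y)=\tfrac16\varphi^2\|\tilde\alpha\|_{\tilde g}^2\,g(X,Y)+\|\tilde\beta\|_{\tilde g}^2S_\nu(X,Y)+\|\tilde\gamma\|_{\tilde g}^2S_\delta(X,Y)+\|\tilde\varpi\|_{\tilde g}^2S_\epsilon(X,Y)+\tilde\psi^2S_\theta(X,Y),$$ $$\mathrm{Ric}_h(\tilde X,\tilde Y)=\varphi^2\tilde S_{\tilde\alpha}(\tilde X,\tilde Y)+\|\nu\|_g^2\tilde S_{\tilde\beta}(\tilde X,\tilde Y)+\|\delta\|_g^2\tilde S_{\tilde\gamma}(\tilde X,\tilde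 Y)+\|\epsilon\|_g^2\tilde S_{\tilde\varpi}(\tilde X,\tilde Y)+\tfrac16\tilde\psi^2\|\theta\|_g^2\,\tilde g(\tilde X,\tilde Y),$$ $$0=\mathrm{Ric}_h(X,\tilde Y)=\tfrac12\Big(\varphi\,\nu(X)\langle\tilde\beta,\tilde Y\lrcorner\tilde\alpha\rangle_{\tilde g}-\langle\tilde\gamma\wedge(X\lrcorner\delta),(\tilde Y\lrcorner\tilde\beta)\wedge\nu\rangle_h+\langle\tilde\varpi\wedge(X\lrcorner\epsilon),(\tilde Y\lrcorner\tilde\gamma)\wedge\delta\rangle_h-\tilde\psi\,\tilde\varpi(\tilde Y)\langle X\lrcorner\theta,\epsilon\rangle_g\Big).$$ Moreover, in each of the following nine cases $F$ satisfies the supergravity Einstein equation if and only if the listed equations hold at all points and for all $X,Y,\tilde X,\tilde Y$ (arguments $(X,Y)$, $(\tilde X,\tilde Y)$ omitted; $\mathrm{Ric}^M$ and $\mathrm{Ric}^{\widetilde M}$ denote the restrictions of $\mathrm{Ric}_h$ to vectors tangent to $M$, respectively $\widetilde M$): 1. $F=\tilde\alpha$: $\mathrm{Ric}^M=\frac16\|\tilde\alpha\|^2_{\tilde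 g}\,g$ and $\mathrm{Ric}^{\widetilde M}=\tilde S_{\tilde\alpha}$. 2. $F=\tilde\beta\wedge\nu$: $\mathrm{Ric}^M=\|\tilde\beta\|^2_{\tilde g}S_\nu$ and $\mathrm{Ric}^{\widetilde M}=\|\nu\|_g^2\tilde S_{\tilde\beta}$. 3. $F=\tilde\gamma\wedge\delta$: $\mathrm{Ric}^M=\|\tilde\gamma\|^2_{\tilde g}S_\delta$ and $\mathrm{Ric}^{\widetilde M}=\|\delta\|_g^2\tilde S_{\tilde\gamma}$. 4. $F=\tilde\varpi\wedge\epsilon$: $\mathrm{Ric}^M=\|\tilde\varpi\|^2_{\tilde g}S_\epsilon$ and $\mathrm{Ric}^{\widetilde M}=\|\epsilon\|_g^2\tilde S_{\tilde\varpi}$. 5. $F=\theta$: $\mathrm{Ric}^M=S_\theta$ and $\mathrm{Ric}^{\widetilde M}=\frac16\|\theta\|_g^2\,\tilde g$. 6. $F=\varphi\tilde\alpha+\tilde\beta\wedge\nu$: $\mathrm{Ric}^M=\frac16\varphi^2\|\tilde\alpha\|^2_{\tilde g}\,g+\|\tilde\beta\|^2_{\tilde g}S_\nu$, $\mathrm{Ric}^{\widetilde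 M}=\varphi^2\tilde S_{\tilde\alpha}+\|\nu\|_g^2\tilde S_{\tilde\beta}$ and $0=\varphi\,\nu(X)\langle\tilde\beta,\tilde Y\lrcorner\tilde\alpha\rangle_{\tilde g}$. 7. $F=\tilde\varpi\wedge\epsilon+\tilde\psi\theta$: $\mathrm{Ric}^M=\|\tilde\varpi\|^2_{\tilde g}S_\epsilon+\tilde\psi^2S_\theta$, $\mathrm{Ric}^{\widetilde M}=\|\epsilon\|_g^2\tilde S_{\tilde\varpi}+\frac16\tilde\psi^2\|\theta\|_g^2\,\tilde g$ and $0=\tilde\psi\,\tilde\varpi(\tilde Y)\langle X\lrcorner\theta,\epsilon\rangle_g$. 8. $F=\tilde\alpha+\theta$: $\mathrm{Ric}^M=\frac16\|\tilde\alpha\|^2_{\tilde g}\,g+S_\theta$ and $\mathrm{Ric}^{\widetilde M}=\tilde S_{\tilde\alpha}+\frac16\|\theta\|_g^2\,\tilde g$. 9. $F=\tilde\beta\wedge\nu+\tilde\varpi\wedge\epsilon$: $\mathrm{Ric}^M=\|\tilde\beta\|^2_{\tilde g}S_\nu+\|\tilde\varpi\|^2_{\tilde g}S_\epsilon$ and $\mathrm{Ric}^{\widetilde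 M}=\|\nu\|_g^2\tilde S_{\tilde\beta}+\|\epsilon\|_g^2\tilde S_{\tilde\varpi}$. -/

import Mathlib

open scoped Manifold ContDiff

set_option maxSynthPendingDepth 3

noncomputable section

namespace Sugra

section LinearAlgebra

variable {V : Type*} [AddCommGroup V] [Module ℝ V]

/-- The wedge product of alternating forms, in the convention
`(α ∧ β)(v₁, …, v_{k+l}) = ∑ sgn(σ) α(v_{σ 1}, …, v_{σ k}) β(v_{σ (k+1)}, …, v_{σ (k+l)})`,
the sum being over all `(k, l)`-shuffles `σ`. -/
def wedge {k l : ℕ} (α : V [⋀^Fin k]→ₗ[ℝ] ℝ) (β : V [⋀^Fin l]→ₗ[ℝ] ℝ) :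
    V [⋀^Fin (k + l)]→ₗ[ℝ] ℝ :=
  ((LinearMap.mul' ℝ ℝ).compAlternatingMap (α.domCoprod β)).domDomCongr finSumFinEquiv

lemma wedge_apply {k l : ℕ} (α : V [⋀^Fin k]→ₗ[ℝ] ℝ) (β : V [⋀^Fin l]→ₗ[ℝ] ℝ)
    (v : Fin (k + l) → V) : wedge α β v = ∑ σ : Equiv.Perm.ModSumCongr (Fin k) (Fin l),
      LinearMap.mul' ℝ ℝ (AlternatingMap.domCoprod.summand α β σ (v ∘ finSumFinEquiv)) := by
  simp only [wedge, AlternatingMap.domDomCongr_apply, LinearMap.compAlternatingMap_apply,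
    AlternatingMap.domCoprod_apply, sum_apply, map_sum]

/-- The interior product `X ⌟ α`. -/
def interior {k : ℕ} (X : V) (α : V [⋀^Fin (k + 1)]→ₗ[ℝ] ℝ) : V [⋀^Fin k]→ₗ[ℝ] ℝ :=
  α.curryLeft X

/-- `(1 / k!) ∑ α_{i₁ … i_k} β_{j₁ … j_k} h^{i₁ j₁} ⋯ h^{i_k j_k}`, in the basis `b`. -/
def formInnerBasis {ι : Type*} [Fintype ι] [DecidableEq ι] (b : Module.Basis ι ℝ V)
    (h : LinearMap.BilinForm ℝ V) {k : ℕ} (α β : V [⋀^Fin k]→ₗ[ℝ] ℝ) : ℝ :=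
  (1 / (k.factorial : ℝ)) * ∑ i : Fin k → ι, ∑ j : Fin k → ι,
    α (fun l => b (i l)) * β (fun l => b (j l)) * ∏ l, (LinearMap.BilinForm.toMatrix b h)⁻¹ (i l) (j l)

/-- The scalar product `⟨α, β⟩_h` of two `k`-forms on a finite dimensional space with a
nondegenerate symmetric bilinear form `h`. It does not depend on the basis chosen here, see
`formInner_eq`. -/
def formInner [FiniteDimensional ℝ V] (h : LinearMap.BilinForm ℝ V) {k : ℕ}
    (α β : V [⋀^Fin k]→ₗ[ℝ] ℝ) : ℝ :=
  formInnerBasis (Module.finBasis ℝ V) h α β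

/-- The square `‖α‖²_h = ⟨α, α⟩_h` (which may be negative). -/
def formNormSq [FiniteDimensional ℝ V] (h : LinearMap.BilinForm ℝ V) {k : ℕ}
    (α : V [⋀^Fin k]→ₗ[ℝ] ℝ) : ℝ :=
  formInner h α α

lemma expand_basis {ι κ : Type*} [Fintype ι] [Fintype κ] (b : Module.Basis ι ℝ V)
    (c : Module.Basis κ ℝ V) {k : ℕ} (α : V [⋀^Fin k]→ₗ[ℝ] ℝ) (i : Fin k → κ) :
    α (fun l => c (i l)) =
      ∑ m : Fin k → ι, (∏ l, b.repr (c (i l)) (m l)) * α (fun l => b (m l)) := by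
  classical
  have h : (fun l => c (i l)) = fun l => ∑ m, b.repr (c (i l)) m • b m := by
    funext l; exact (b.sum_repr _).symm
  rw [h, ← AlternatingMap.coe_multilinearMap, MultilinearMap.map_sum]
  refine Finset.sum_congr rfl fun m _ => ?_
  rw [MultilinearMap.map_smul_univ]
  rfl

lemma sum_rotate {A B C D : Type*} [Fintype A] [Fintype B] [Fintype C] [Fintype D]
    {f : A → B → C → D → ℝ} {f' : D → C → A → B → ℝ} (hf : ∀ a b c d, f a b c d = f' d c a b) :
    ∑ a, ∑ b, ∑ c, ∑ d, f a b c d = ∑ d, ∑ c, ∑ a, ∑ b, f' d c a b := by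
  simp only [hf]
  calc _ = ∑ a, ∑ b, ∑ d, ∑ c, f' d c a b :=
        Finset.sum_congr rfl fun a _ => Finset.sum_congr rfl fun b _ => Finset.sum_comm
    _ = ∑ a, ∑ d, ∑ b, ∑ c, f' d c a b := Finset.sum_congr rfl fun a _ => Finset.sum_comm
    _ = ∑ d, ∑ a, ∑ b, ∑ c, f' d c a b := Finset.sum_comm
    _ = ∑ d, ∑ a, ∑ c, ∑ b, f' d c a b :=
        Finset.sum_congr rfl fun d _ => Finset.sum_congr rfl fun a _ => Finset.sum_comm
    _ = ∑ d, ∑ c, ∑ a, ∑ b, f' d c a b := Finset.sum_congr rfl fun d _ => Finset.sum_comm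

/-- The scalar product of forms can be computed in any basis. -/
theorem formInner_eq [FiniteDimensional ℝ V] {ι : Type*} [Fintype ι] [DecidableEq ι]
    (b : Module.Basis ι ℝ V) (h : LinearMap.BilinForm ℝ V) (hh : h.Nondegenerate) {k : ℕ}
    (α β : V [⋀^Fin k]→ₗ[ℝ] ℝ) : formInner h α β = formInnerBasis b h α β := by
  classical
  unfold formInner
  set c := Module.finBasis ℝ V
  have key : (b.toMatrix c) * (LinearMap.BilinForm.toMatrix c h)⁻¹ * (b.toMatrix c).transpose = (LinearMap.BilinForm.toMatrix b h)⁻¹ := by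
    have h1 : LinearMap.BilinForm.toMatrix c h = (b.toMatrix c).transpose * (LinearMap.BilinForm.toMatrix b h) * b.toMatrix c :=
      (LinearMap.BilinForm.toMatrix_mul_basis_toMatrix b c h).symm
    have h2 : IsUnit (LinearMap.BilinForm.toMatrix c h).det :=
      ((LinearMap.BilinForm.nondegenerate_iff_det_ne_zero c).1 hh).isUnit
    have h3 : b.toMatrix c * c.toMatrix b = 1 := b.toMatrix_mul_toMatrix_flip c
    symm
    apply Matrix.inv_eq_left_inv
    calc _ = b.toMatrix c * (LinearMap.BilinForm.toMatrix c h)⁻¹ * ((b.toMatrix c).transpose * (LinearMap.BilinForm.toMatrix b h)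
          * (b.toMatrix c * c.toMatrix b)) := by
            rw [h3, Matrix.mul_one]; simp only [Matrix.mul_assoc]
      _ = b.toMatrix c * ((LinearMap.BilinForm.toMatrix c h)⁻¹ * LinearMap.BilinForm.toMatrix c h) * c.toMatrix b := by
            rw [h1]; simp only [Matrix.mul_assoc]
      _ = 1 := by rw [Matrix.nonsing_inv_mul _ h2, Matrix.mul_one, h3]
  unfold formInnerBasis
  congr 1
  rw [← key]
  have e : ∀ m n : Fin k → ι, ∏ l, (b.toMatrix c * (LinearMap.BilinForm.toMatrix c h)⁻¹ * (b.toMatrix c).transpose)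
      (m l) (n l) = ∑ i : Fin k → Fin (Module.finrank ℝ V), ∑ j : Fin k → Fin (Module.finrank ℝ V),
        (∏ l, b.repr (c (i l)) (m l)) * (∏ l, b.repr (c (j l)) (n l)) *
          ∏ l, (LinearMap.BilinForm.toMatrix c h)⁻¹ (i l) (j l) := by
    intro m n
    have : ∀ l, (b.toMatrix c * (LinearMap.BilinForm.toMatrix c h)⁻¹ * (b.toMatrix c).transpose) (m l) (n l) =
        ∑ i, ∑ j, b.repr (c i) (m l) * b.repr (c j) (n l) * (LinearMap.BilinForm.toMatrix c h)⁻¹ i j := by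
      intro l
      simp only [Matrix.mul_apply, Matrix.transpose_apply, Module.Basis.toMatrix_apply,
        Finset.sum_mul]
      rw [Finset.sum_comm]
      exact Finset.sum_congr rfl fun i _ => Finset.sum_congr rfl fun j _ => by ring
    simp only [this]
    rw [Fintype.prod_sum]
    refine Finset.sum_congr rfl fun i _ => ?_
    rw [Fintype.prod_sum]
    refine Finset.sum_congr rfl fun j _ => ?_
    simp only [Finset.prod_mul_distrib]
  simp only [e, expand_basis b c α, expand_basis b c β]
  simp only [Finset.sum_mul, Finset.mul_sum]
  exact sum_rotate fun i j n m => by ring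

end LinearAlgebra

section Manifold

variable {E : Type*} [NormedAddCommGroup E] [NormedSpace ℝ E]
  {H : Type*} [TopologicalSpace H] (I : ModelWithCorners ℝ E H)
  {M : Type*} [TopologicalSpace M] [ChartedSpace H M]

instance [FiniteDimensional ℝ E] (x : M) : FiniteDimensional ℝ (TangentSpace I x) :=
  inferInstanceAs (FiniteDimensional ℝ E)

/-- The coordinate frame of the chart at `x₀`, at the point with coordinates `y`: the differential
of the inverse chart. All manifolds here are without boundary. -/
def frame (x₀ : M) (y : E) : E →L[ℝ] TangentSpace I ((extChartAt I x₀).symm y) :=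
  mfderiv 𝓘(ℝ, E) I (extChartAt I x₀).symm y

variable {I} in
/-- The coordinate expression `y ↦ g_y(·,·)`, in the chart at `x₀`, of a field of bilinear forms. -/
def localBilin (g : ∀ x : M, TangentSpace I x →L[ℝ] TangentSpace I x →L[ℝ] ℝ) (x₀ : M) (y : E) :
    E →L[ℝ] E →L[ℝ] ℝ :=
  (ContinuousLinearMap.precomp ℝ (frame I x₀ y)) ∘L (g ((extChartAt I x₀).symm y)) ∘L
    (frame I x₀ y)

variable (M)

/-- A smooth pseudo-Riemannian metric. -/
structure Metric where
  inner : ∀ x : M, TangentSpace I x →L[ℝ] TangentSpace I x →L[ℝ] ℝ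
  symm : ∀ x v w, inner x v w = inner x w v
  nondegenerate : ∀ x v, (∀ w, inner x v w = 0) → v = 0
  smooth : ∀ x₀ : M, ContDiffOn ℝ ∞ (localBilin inner x₀) (extChartAt I x₀).target

/-- A smooth differential `k`-form: its components in each chart are smooth. -/
structure Form (k : ℕ) where
  toFun : ∀ x : M, TangentSpace I x [⋀^Fin k]→ₗ[ℝ] ℝ
  smooth : ∀ (x₀ : M) (v : Fin k → E),
    ContDiffOn ℝ ∞ (fun y => toFun ((extChartAt I x₀).symm y) (fun i => frame I x₀ y (v i)))
      (extChartAt I x₀).target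

variable {I M}

instance (k : ℕ) : CoeFun (Form I M k) fun _ => ∀ x : M, TangentSpace I x [⋀^Fin k]→ₗ[ℝ] ℝ :=
  ⟨Form.toFun⟩

instance (k : ℕ) : Add (Form I M k) where
  add α β :=
    { toFun := fun x => α x + β x
      smooth := fun x₀ v => (α.smooth x₀ v).add (β.smooth x₀ v) }

/-- Multiplication of a form by a smooth function. -/
instance [I.Boundaryless] [IsManifold I ∞ M] (k : ℕ) : SMul C^∞⟮I, M; ℝ⟯ (Form I M k) where
  smul f α :=
    { toFun := fun x => f x • α x
      smooth := fun x₀ v => by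
        have h := f.contMDiff.comp_contMDiffOn (contMDiffOn_extChartAt_symm (I := I) (n := ∞) x₀)
        exact (contMDiffOn_iff_contDiffOn.1 h).mul (α.smooth x₀ v) }

/-- The wedge product of two differential forms. -/
def Form.wedge {k l : ℕ} (α : Form I M k) (β : Form I M l) : Form I M (k + l) where
  toFun x := Sugra.wedge (α x) (β x)
  smooth x₀ v := by
    simp only [wedge_apply]
    refine ContDiffOn.sum fun σ _ => ?_
    induction σ using Quotient.inductionOn' with | _ σ
    simp only [AlternatingMap.domCoprod.summand_mk'', smul_apply,
      MultilinearMap.domDomCongr_apply, MultilinearMap.domCoprod_apply, map_zsmul_unit,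
      LinearMap.mul'_apply]
    exact ((α.smooth x₀ fun i => v (finSumFinEquiv (σ (Sum.inl i)))).mul
      (β.smooth x₀ fun i => v (finSumFinEquiv (σ (Sum.inr i))))).const_smul _

/-- The metric at a point, as an algebraic bilinear form on the tangent space. -/
def Metric.bilin (g : Metric I M) (x : M) : LinearMap.BilinForm ℝ (TangentSpace I x) :=
  LinearMap.mk₂ ℝ (fun v w => g.inner x v w) (by simp) (by simp) (by simp) (by simp)

/-- A Lorentzian metric in the mostly minus convention, i.e. of signature `(+, -, …, -)`. -/
def Metric.IsLorentzian (g : Metric I M) : Prop :=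
  ∀ x : M, ∃ t : TangentSpace I x, 0 < g.inner x t t ∧
    ∀ v, g.inner x t v = 0 → v ≠ 0 → g.inner x v v < 0

/-- A Riemannian metric in the mostly minus convention, i.e. a negative definite one. -/
def Metric.IsNegDef (g : Metric I M) : Prop :=
  ∀ (x : M) (v : TangentSpace I x), v ≠ 0 → g.inner x v v < 0

end Manifold

section Ricci

variable {E : Type*} [NormedAddCommGroup E] [NormedSpace ℝ E]

/-- `(u, v, w) ↦ (D u v w + D v u w - D w u v) / 2`. For the derivative `D u v w = ∂_u G(v, w)` of
a metric this is `G(∇_u v, w)`, for constant vector fields `u, v, w`. -/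
def koszul (D : E →L[ℝ] E →L[ℝ] E →L[ℝ] ℝ) : E →L[ℝ] E →L[ℝ] E →L[ℝ] ℝ :=
  (1 / 2 : ℝ) • (D + D.flip -
    (ContinuousLinearMap.flipₗᵢ ℝ E E ℝ).toLinearIsometry.toContinuousLinearMap ∘L D.flip)

lemma koszul_apply (D : E →L[ℝ] E →L[ℝ] E →L[ℝ] ℝ) (u v w : E) :
    koszul D u v w = (D u v w + D v u w - D w u v) / 2 := by
  simp [koszul]; ring

/-- The Christoffel symbols `Γ_y(u, v) = ∇_u v` (for constant vector fields `u, v`) of the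
Levi-Civita connection of a metric `G` on an open subset of `E`; the index is raised by the inverse
of `G y : E → E*`. -/
def christoffel (G : E → E →L[ℝ] E →L[ℝ] ℝ) (y : E) : E →L[ℝ] E →L[ℝ] E :=
  (ContinuousLinearMap.compL ℝ E (E →L[ℝ] ℝ) E (G y).inverse) ∘L koszul (fderiv ℝ G y)

lemma christoffel_apply (G : E → E →L[ℝ] E →L[ℝ] ℝ) (y u v : E) :
    christoffel G y u v = (G y).inverse (koszul (fderiv ℝ G y) u v) := rfl

/-- The linear map `w ↦ R(w, u) v = ∇_w ∇_u v - ∇_u ∇_w v`, for constant vector fields, i.e.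
`∂_w Γ(u, v) - ∂_u Γ(w, v) + Γ(w, Γ(u, v)) - Γ(u, Γ(w, v))`. -/
def curvature (G : E → E →L[ℝ] E →L[ℝ] ℝ) (y u v : E) : E →L[ℝ] E :=
  ((fderiv ℝ (christoffel G) y).flip u).flip v - (fderiv ℝ (christoffel G) y u).flip v
    + (christoffel G y).flip (christoffel G y u v)
    - (christoffel G y u) ∘L ((christoffel G y).flip v)

lemma curvature_apply (G : E → E →L[ℝ] E →L[ℝ] ℝ) (y u v w : E) :
    curvature G y u v w = fderiv ℝ (christoffel G) y w u v - fderiv ℝ (christoffel G) y u w v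
      + christoffel G y w (christoffel G y u v) - christoffel G y u (christoffel G y w v) := rfl

/-- The Ricci tensor `Ric(u, v) = tr (w ↦ R(w, u) v)` of a metric on an open subset of `E`. -/
def ricciLocal (G : E → E →L[ℝ] E →L[ℝ] ℝ) (y u v : E) : ℝ :=
  LinearMap.trace ℝ E (curvature G y u v)

variable {H : Type*} [TopologicalSpace H] {I : ModelWithCorners ℝ E H}
  {M : Type*} [TopologicalSpace M] [ChartedSpace H M]

/-- The Ricci tensor `Ric_g(X, Y)` at `x`, computed in the chart at `x`. -/
def Metric.ricci (g : Metric I M) (x : M) (X Y : TangentSpace I x) : ℝ :=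
  ricciLocal (localBilin g.inner x) (extChartAt I x x)
    (mfderiv I 𝓘(ℝ, E) (extChartAt I x) x X) (mfderiv I 𝓘(ℝ, E) (extChartAt I x) x Y)

/-- The supergravity Einstein equation
`Ric_g(X, Y) = - ⟨X ⌟ F, Y ⌟ F⟩_g / 2 + g(X, Y) ‖F‖²_g / 6`. -/
def EinsteinEquation [FiniteDimensional ℝ E] (g : Metric I M) (F : Form I M 4) : Prop :=
  ∀ (x : M) (X Y : TangentSpace I x),
    g.ricci x X Y = -(1 / 2) * formInner (g.bilin x) (interior X (F x)) (interior Y (F x))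
      + 1 / 6 * g.inner x X Y * formNormSq (g.bilin x) (F x)

end Ricci

section Product

variable {E : Type*} [NormedAddCommGroup E] [NormedSpace ℝ E]
  {H : Type*} [TopologicalSpace H] {I : ModelWithCorners ℝ E H}
  {M : Type*} [TopologicalSpace M] [ChartedSpace H M]
  {E' : Type*} [NormedAddCommGroup E'] [NormedSpace ℝ E']
  {H' : Type*} [TopologicalSpace H'] {J : ModelWithCorners ℝ E' H'}
  {N : Type*} [TopologicalSpace N] [ChartedSpace H' N]

variable (I J) in
/-- The differential of the projection `M × N → M`. -/
def tangentFst (p : M × N) : TangentSpace (I.prod J) p →L[ℝ] TangentSpace I p.1 :=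
  mfderiv (I.prod J) I Prod.fst p

variable (I J) in
/-- The differential of the projection `M × N → N`. -/
def tangentSnd (p : M × N) : TangentSpace (I.prod J) p →L[ℝ] TangentSpace J p.2 :=
  mfderiv (I.prod J) J Prod.snd p

variable (I J) in
/-- The inclusion of `T_x M` into `T_{(x, y)} (M × N)`. -/
def tangentInl (p : M × N) : TangentSpace I p.1 →L[ℝ] TangentSpace (I.prod J) p :=
  mfderiv I (I.prod J) (fun x => (x, p.2)) p.1

variable (I J) in
/-- The inclusion of `T_y N` into `T_{(x, y)} (M × N)`. -/
def tangentInr (p : M × N) : TangentSpace J p.2 →L[ℝ] TangentSpace (I.prod J) p :=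
  mfderiv J (I.prod J) (fun y => (p.1, y)) p.2

lemma tangentFst_apply (p : M × N) (v : E × E') : tangentFst I J p v = v.1 := by
  rw [tangentFst, mfderiv_fst]; rfl

lemma tangentSnd_apply (p : M × N) (v : E × E') : tangentSnd I J p v = v.2 := by
  rw [tangentSnd, mfderiv_snd]; rfl

lemma tangentInl_apply (p : M × N) (v : E) : tangentInl I J p v = ((v, 0) : E × E') := by
  rw [tangentInl, mfderiv_prod_left]; rfl

lemma tangentInr_apply (p : M × N) (v : E') : tangentInr I J p v = ((0, v) : E × E') := by
  rw [tangentInr, mfderiv_prod_right]; rfl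

lemma frame_prod [I.Boundaryless] [J.Boundaryless] [IsManifold I ∞ M] [IsManifold J ∞ N]
    (p : M × N) (y : E × E') (hy : y ∈ (extChartAt (I.prod J) p).target) (v : E × E') :
    frame (I.prod J) p y v = ((frame I p.1 y.1 v.1, frame J p.2 y.2 v.2) : E × E') := by
  rw [extChartAt_prod, PartialEquiv.prod_target] at hy
  have h₁ : MDifferentiableAt 𝓘(ℝ, E) I (extChartAt I p.1).symm y.1 := by
    have h := mdifferentiableWithinAt_extChartAt_symm (I := I) hy.1
    rwa [I.range_eq_univ, mdifferentiableWithinAt_univ] at h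
  have h₂ : MDifferentiableAt 𝓘(ℝ, E') J (extChartAt J p.2).symm y.2 := by
    have h := mdifferentiableWithinAt_extChartAt_symm (I := J) hy.2
    rwa [J.range_eq_univ, mdifferentiableWithinAt_univ] at h
  have k₁ := h₁.hasMFDerivAt.comp y (hasFDerivAt_fst (𝕜 := ℝ) (p := y)).hasMFDerivAt
  have k₂ := h₂.hasMFDerivAt.comp y (hasFDerivAt_snd (𝕜 := ℝ) (p := y)).hasMFDerivAt
  have k := (k₁.prodMk k₂).mfderiv
  exact DFunLike.congr_fun k v

lemma mapsTo_fst (p : M × N) : Set.MapsTo (Prod.fst : E × E' → E)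
    (extChartAt (I.prod J) p).target (extChartAt I p.1).target := fun y hy => by
  rw [extChartAt_prod, PartialEquiv.prod_target] at hy
  exact hy.1

lemma mapsTo_snd (p : M × N) : Set.MapsTo (Prod.snd : E × E' → E')
    (extChartAt (I.prod J) p).target (extChartAt J p.2).target := fun y hy => by
  rw [extChartAt_prod, PartialEquiv.prod_target] at hy
  exact hy.2

lemma fst_inl (p : M × N) (v : TangentSpace I p.1) :
    tangentFst I J p (tangentInl I J p v) = v :=
  (congrArg (tangentFst I J p) (tangentInl_apply (E := E) p v)).trans (tangentFst_apply p _)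

lemma snd_inl (p : M × N) (v : TangentSpace I p.1) :
    tangentSnd I J p (tangentInl I J p v) = 0 :=
  (congrArg (tangentSnd I J p) (tangentInl_apply (E := E) p v)).trans (tangentSnd_apply p _)

lemma fst_inr (p : M × N) (v : TangentSpace J p.2) :
    tangentFst I J p (tangentInr I J p v) = 0 :=
  (congrArg (tangentFst I J p) (tangentInr_apply (E' := E') p v)).trans (tangentFst_apply p _)

lemma snd_inr (p : M × N) (v : TangentSpace J p.2) :
    tangentSnd I J p (tangentInr I J p v) = v :=
  (congrArg (tangentSnd I J p) (tangentInr_apply (E' := E') p v)).trans (tangentSnd_apply p _)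

/-- The product metric `g̃ + g` on `M × N`. -/
def Metric.prod [I.Boundaryless] [J.Boundaryless] [IsManifold I ∞ M] [IsManifold J ∞ N]
    (g₁ : Metric I M) (g₂ : Metric J N) : Metric (I.prod J) (M × N) where
  inner p := ContinuousLinearMap.precomp ℝ (tangentFst I J p) ∘L g₁.inner p.1 ∘L tangentFst I J p
    + ContinuousLinearMap.precomp ℝ (tangentSnd I J p) ∘L g₂.inner p.2 ∘L tangentSnd I J p
  symm p v w := congrArg₂ (· + ·) (g₁.symm _ _ _) (g₂.symm _ _ _)
  nondegenerate p v h := by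
    have h1 : tangentFst I J p v = 0 := g₁.nondegenerate _ _ fun w => by
      have h0 := h (tangentInl I J p w)
      simpa [fst_inl, snd_inl] using h0
    have h2 : tangentSnd I J p v = 0 := g₂.nondegenerate _ _ fun w => by
      have h0 := h (tangentInr I J p w)
      simpa [fst_inr, snd_inr] using h0
    exact Prod.ext ((tangentFst_apply p v).symm.trans h1) ((tangentSnd_apply p v).symm.trans h2)
  smooth p := by
    have h₁ := (g₁.smooth p.1).comp
      (contDiff_fst.contDiffOn (s := (extChartAt (I.prod J) p).target)) (mapsTo_fst p)
    have h₂ := (g₂.smooth p.2).comp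
      (contDiff_snd.contDiffOn (s := (extChartAt (I.prod J) p).target)) (mapsTo_snd p)
    refine ((contDiffOn_const (c := ContinuousLinearMap.precomp ℝ
        (ContinuousLinearMap.fst ℝ E E'))).clm_comp
      (h₁.clm_comp (contDiffOn_const (c := ContinuousLinearMap.fst ℝ E E')))).add
      ((contDiffOn_const (c := ContinuousLinearMap.precomp ℝ
        (ContinuousLinearMap.snd ℝ E E'))).clm_comp
      (h₂.clm_comp (contDiffOn_const (c := ContinuousLinearMap.snd ℝ E E'))))
      |>.congr fun y hy => ?_
    have e₁ : ∀ v, tangentFst I J _ (frame (I.prod J) p y v) = frame I p.1 y.1 v.1 :=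
      fun v => by rw [frame_prod p y hy, tangentFst_apply]
    have e₂ : ∀ v, tangentSnd I J _ (frame (I.prod J) p y v) = frame J p.2 y.2 v.2 :=
      fun v => by rw [frame_prod p y hy, tangentSnd_apply]
    refine ContinuousLinearMap.ext fun v => ContinuousLinearMap.ext fun w => ?_
    exact congrArg₂ (· + ·)
      (congrArg₂ (fun a b => g₁.inner ((extChartAt I p.1).symm y.1) a b) (e₁ v) (e₁ w))
      (congrArg₂ (fun a b => g₂.inner ((extChartAt J p.2).symm y.2) a b) (e₂ v) (e₂ w))

/-- The pullback to `T_p (M × N)` of an alternating form on the tangent space of `M`. -/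
def liftFst (p : M × N) {k : ℕ} (α : TangentSpace I p.1 [⋀^Fin k]→ₗ[ℝ] ℝ) :
    TangentSpace (I.prod J) p [⋀^Fin k]→ₗ[ℝ] ℝ :=
  α.compLinearMap (tangentFst I J p)

/-- The pullback to `T_p (M × N)` of an alternating form on the tangent space of `N`. -/
def liftSnd (p : M × N) {k : ℕ} (α : TangentSpace J p.2 [⋀^Fin k]→ₗ[ℝ] ℝ) :
    TangentSpace (I.prod J) p [⋀^Fin k]→ₗ[ℝ] ℝ :=
  α.compLinearMap (tangentSnd I J p)

/-- The pullback of a `k`-form under the projection `M × N → M`. -/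
def Form.fst [I.Boundaryless] [J.Boundaryless] [IsManifold I ∞ M] [IsManifold J ∞ N]
    {k : ℕ} (α : Form I M k) : Form (I.prod J) (M × N) k where
  toFun p := liftFst p (α p.1)
  smooth p v := by
    refine ((α.smooth p.1 fun i => (v i).1).comp
      (contDiff_fst.contDiffOn (s := (extChartAt (I.prod J) p).target))
      (mapsTo_fst p)).congr fun y hy => ?_
    have e : ∀ i, tangentFst I J _ (frame (I.prod J) p y (v i)) = frame I p.1 y.1 (v i).1 :=
      fun i => by rw [frame_prod p y hy, tangentFst_apply]
    exact congrArg (α ((extChartAt I p.1).symm y.1)) (funext e)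

/-- The pullback of a `k`-form under the projection `M × N → N`. -/
def Form.snd [I.Boundaryless] [J.Boundaryless] [IsManifold I ∞ M] [IsManifold J ∞ N]
    {k : ℕ} (α : Form J N k) : Form (I.prod J) (M × N) k where
  toFun p := liftSnd p (α p.2)
  smooth p v := by
    refine ((α.smooth p.2 fun i => (v i).2).comp
      (contDiff_snd.contDiffOn (s := (extChartAt (I.prod J) p).target))
      (mapsTo_snd p)).congr fun y hy => ?_
    have e : ∀ i, tangentSnd I J _ (frame (I.prod J) p y (v i)) = frame J p.2 y.2 (v i).2 :=
      fun i => by rw [frame_prod p y hy, tangentSnd_apply]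
    exact congrArg (α ((extChartAt J p.2).symm y.2)) (funext e)

/-- Multiplication of a form on `M × N` by the pullback of a smooth function on `M`. -/
def smulFst [I.Boundaryless] [J.Boundaryless] [IsManifold I ∞ M] [IsManifold J ∞ N]
    {k : ℕ} (f : C^∞⟮I, M; ℝ⟯) (α : Form (I.prod J) (M × N) k) : Form (I.prod J) (M × N) k :=
  (f.comp ContMDiffMap.fst : C^∞⟮I.prod J, M × N; ℝ⟯) • α

/-- Multiplication of a form on `M × N` by the pullback of a smooth function on `N`. -/
def smulSnd [I.Boundaryless] [J.Boundaryless] [IsManifold I ∞ M] [IsManifold J ∞ N]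
    {k : ℕ} (f : C^∞⟮J, N; ℝ⟯) (α : Form (I.prod J) (M × N) k) : Form (I.prod J) (M × N) k :=
  (f.comp ContMDiffMap.snd : C^∞⟮I.prod J, M × N; ℝ⟯) • α

/-- `Ric_h(X̃, Ỹ)` for `h = g̃ + g` and `X̃, Ỹ` tangent to the first factor. -/
def ricci₁₁ [I.Boundaryless] [J.Boundaryless] [IsManifold I ∞ M] [IsManifold J ∞ N]
    (g₁ : Metric I M) (g₂ : Metric J N) (p : M × N) (X Y : TangentSpace I p.1) : ℝ :=
  (g₁.prod g₂).ricci p (tangentInl I J p X) (tangentInl I J p Y)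

/-- `Ric_h(X, Y)` for `h = g̃ + g` and `X, Y` tangent to the second factor. -/
def ricci₂₂ [I.Boundaryless] [J.Boundaryless] [IsManifold I ∞ M] [IsManifold J ∞ N]
    (g₁ : Metric I M) (g₂ : Metric J N) (p : M × N) (X Y : TangentSpace J p.2) : ℝ :=
  (g₁.prod g₂).ricci p (tangentInr I J p X) (tangentInr I J p Y)

/-- `Ric_h(X, Ỹ)` for `h = g̃ + g`, `X` tangent to the second factor and `Ỹ` to the first one. -/
def ricci₂₁ [I.Boundaryless] [J.Boundaryless] [IsManifold I ∞ M] [IsManifold J ∞ N]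
    (g₁ : Metric I M) (g₂ : Metric J N) (p : M × N) (X : TangentSpace J p.2)
    (Y : TangentSpace I p.1) : ℝ :=
  (g₁.prod g₂).ricci p (tangentInr I J p X) (tangentInl I J p Y)

end Product

section Contractions

variable {E : Type*} [NormedAddCommGroup E] [NormedSpace ℝ E] [FiniteDimensional ℝ E]
  {H : Type*} [TopologicalSpace H] {I : ModelWithCorners ℝ E H}
  {M : Type*} [TopologicalSpace M] [ChartedSpace H M]

/-- The function `‖α‖²_g`. -/
def Metric.normSq (g : Metric I M) {k : ℕ} (α : Form I M k) (x : M) : ℝ :=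
  formNormSq (g.bilin x) (α x)

/-- The bilinear form `⟨X ⌟ α, Y ⌟ α⟩_g`. -/
def Metric.contr (g : Metric I M) {k : ℕ} (α : Form I M (k + 1)) (x : M)
    (X Y : TangentSpace I x) : ℝ :=
  formInner (g.bilin x) (interior X (α x)) (interior Y (α x))

end Contractions

section Flux

variable {M₁ : Type*} [TopologicalSpace M₁] [ChartedSpace (EuclideanSpace ℝ (Fin 5)) M₁]
  [IsManifold (𝓡 5) ∞ M₁]
  {M₂ : Type*} [TopologicalSpace M₂] [ChartedSpace (EuclideanSpace ℝ (Fin 6)) M₂]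
  [IsManifold (𝓡 6) ∞ M₂]

/-- The flux form `φ α̃ + β̃ ∧ ν + γ̃ ∧ δ + ϖ̃ ∧ ε + ψ̃ θ`. -/
def flux (φ : C^∞⟮𝓡 6, M₂; ℝ⟯) (α : Form (𝓡 5) M₁ 4)
    (β : Form (𝓡 5) M₁ 3) (ν : Form (𝓡 6) M₂ 1)
    (γ : Form (𝓡 5) M₁ 2) (δ : Form (𝓡 6) M₂ 2)
    (ϖ : Form (𝓡 5) M₁ 1) (ε : Form (𝓡 6) M₂ 3)
    (ψ : C^∞⟮𝓡 5, M₁; ℝ⟯) (θ : Form (𝓡 6) M₂ 4) :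
    Form ((𝓡 5).prod (𝓡 6)) (M₁ × M₂) 4 :=
  smulSnd φ α.fst + β.fst.wedge ν.snd + γ.fst.wedge δ.snd + ϖ.fst.wedge ε.snd + smulFst ψ θ.snd

end Flux

end Sugra

end

/-!
The product metric `h = g₁ + g₂` is, in a product chart, a sum of two metrics depending on separate
coordinates. Its Christoffel symbols, and therefore its curvature operators, are block diagonal, and
taking traces gives `Ric_h = Ric_{g₁} + Ric_{g₂}` (`ricciLocal_prod`, `ricci_prod`). In particular
the mixed components of `Ric_h` vanish.

What remains is linear algebra at a point, on an orthogonal sum `V₁ × V₂`. Forms of different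
bidegrees are orthogonal (`HasBidegree.formInner_eq_zero`), and
`⟨a ∧ b, a' ∧ b'⟩ = ⟨a, a'⟩ ⟨b, b'⟩` for `a, a'` on `V₁` and `b, b'` on `V₂`
(`IsTensor.formInner_eq_mul`). The contractions of a product are `X ⌟ (a ∧ b) = (X ⌟ a) ∧ b` for
`X ∈ V₁` and `X ⌟ (a ∧ b) = (-1)^k a ∧ (X ⌟ b)` for `X ∈ V₂`, where `a` has degree `k`. To make
these statements independent of the representation of the degree, a product is described by its
bidegree and its values on vectors `x₁, …, x_k ∈ V₁`, `y₁, …, y_l ∈ V₂` (`IsTensor`), instead of by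
an equation with a wedge product.

The five terms of the flux form `F` have the bidegrees `(4, 0)`, …, `(0, 4)`. This gives `‖F‖²` and
the scalar products of `X ⌟ F` and `Y ⌟ F`, for `X` and `Y` tangent to the factors. By bilinearity,
the Einstein equation for `F` is equivalent to its restrictions to pairs of vectors tangent to the
factors (`einsteinEquation_prod_iff`). In the special cases some of the five
terms are zero, and a coefficient function may be constantly `1`.
-/

noncomputable section

namespace Sugra

/-! ### The Ricci tensor of a product of metrics on open sets -/

section LocalRicci

variable {E : Type*} [NormedAddCommGroup E] [NormedSpace ℝ E]
  {E' : Type*} [NormedAddCommGroup E'] [NormedSpace ℝ E']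

lemma fderiv_clm_apply₂ {W F : Type*} [NormedAddCommGroup W] [NormedSpace ℝ W]
    [NormedAddCommGroup F] [NormedSpace ℝ F] {K : W → E →L[ℝ] E' →L[ℝ] F} {y : W}
    (hK : DifferentiableAt ℝ K y) (u : W) (v : E) (w : E') :
    fderiv ℝ K y u v w = fderiv ℝ (fun z => K z v w) y u := by
  have h := (hK.hasFDerivAt.clm_apply (hasFDerivAt_const v y)).clm_apply (hasFDerivAt_const w y)
  rw [h.fderiv]
  simp

/-- The derivative of a field of bilinear maps on `E × E'` that splits into a field depending only
on the first factor and one depending only on the second factor. -/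
lemma fderiv_split {F F₁ F₂ : Type*} [NormedAddCommGroup F] [NormedSpace ℝ F]
    [NormedAddCommGroup F₁] [NormedSpace ℝ F₁] [NormedAddCommGroup F₂] [NormedSpace ℝ F₂]
    (j₁ : F₁ →L[ℝ] F) (j₂ : F₂ →L[ℝ] F)
    {K : E × E' → E × E' →L[ℝ] E × E' →L[ℝ] F} {K₁ : E → E →L[ℝ] E →L[ℝ] F₁}
    {K₂ : E' → E' →L[ℝ] E' →L[ℝ] F₂} {y : E × E'} (hK : DifferentiableAt ℝ K y)
    (hK₁ : DifferentiableAt ℝ K₁ y.1) (hK₂ : DifferentiableAt ℝ K₂ y.2)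
    (h : ∀ᶠ z in nhds y, ∀ v w, K z v w = j₁ (K₁ z.1 v.1 w.1) + j₂ (K₂ z.2 v.2 w.2))
    (u v w : E × E') :
    fderiv ℝ K y u v w =
      j₁ (fderiv ℝ K₁ y.1 u.1 v.1 w.1) + j₂ (fderiv ℝ K₂ y.2 u.2 v.2 w.2) := by
  rw [fderiv_clm_apply₂ hK]
  have h' : (fun z => K z v w) =ᶠ[nhds y]
      fun z => j₁ (K₁ z.1 v.1 w.1) + j₂ (K₂ z.2 v.2 w.2) := h.mono fun z hz => hz v w
  rw [h'.fderiv_eq]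
  have d₁ := ((hK₁.hasFDerivAt.clm_apply (hasFDerivAt_const v.1 y.1)).clm_apply
    (hasFDerivAt_const w.1 y.1)).comp y hasFDerivAt_fst
  have d₂ := ((hK₂.hasFDerivAt.clm_apply (hasFDerivAt_const v.2 y.2)).clm_apply
    (hasFDerivAt_const w.2 y.2)).comp y hasFDerivAt_snd
  have d := (j₁.hasFDerivAt.comp y d₁).add (j₂.hasFDerivAt.comp y d₂)
  refine (DFunLike.congr_fun d.fderiv u).trans ?_
  simp

/-- The Levi-Civita connection of a product metric is the product of the Levi-Civita
connections. -/
lemma christoffel_prod {G : E × E' → E × E' →L[ℝ] E × E' →L[ℝ] ℝ}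
    {G₁ : E → E →L[ℝ] E →L[ℝ] ℝ} {G₂ : E' → E' →L[ℝ] E' →L[ℝ] ℝ} {y : E × E'}
    (h : ∀ᶠ z in nhds y, ∀ v w, G z v w = G₁ z.1 v.1 w.1 + G₂ z.2 v.2 w.2)
    (hG : DifferentiableAt ℝ G y) (hG₁ : DifferentiableAt ℝ G₁ y.1)
    (hG₂ : DifferentiableAt ℝ G₂ y.2) (hi : (G y).IsInvertible) (hi₁ : (G₁ y.1).IsInvertible)
    (hi₂ : (G₂ y.2).IsInvertible) (u v : E × E') :
    christoffel G y u v = (christoffel G₁ y.1 u.1 v.1, christoffel G₂ y.2 u.2 v.2) := by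
  have hD := fderiv_split (.id ℝ ℝ) (.id ℝ ℝ) hG hG₁ hG₂ (by simpa using h)
  simp only [christoffel_apply]
  rw [hi.inverse_apply_eq]
  refine ContinuousLinearMap.ext fun w => ?_
  rw [h.self_of_nhds]
  simp only [hi₁.self_apply_inverse, hi₂.self_apply_inverse, koszul_apply, hD]
  simp
  ring

variable [FiniteDimensional ℝ E] [FiniteDimensional ℝ E']

/-- Lowering an index with a nondegenerate form is invertible. Hence `ContinuousLinearMap.inverse`,
which `christoffel` uses to raise indices and which is `0` at maps that are not invertible, is the
true inverse for every metric. -/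
lemma isInvertible_of_nondegenerate {B : E →L[ℝ] E →L[ℝ] ℝ}
    (hB : ∀ v, (∀ w, B v w = 0) → v = 0) : B.IsInvertible := by
  have hinj : Function.Injective B := (injective_iff_map_eq_zero B).2 fun v hv =>
    hB v fun w => by rw [hv]; rfl
  have hdim : Module.finrank ℝ E = Module.finrank ℝ (E →L[ℝ] ℝ) := by
    rw [← (LinearMap.toContinuousLinearMap (𝕜 := ℝ) (E := E) (F' := ℝ)).finrank_eq]
    exact Subspace.dual_finrank_eq.symm
  refine ⟨(LinearEquiv.ofInjectiveOfFinrankEq (B : E →ₗ[ℝ] E →L[ℝ] ℝ) hinj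
    hdim).toContinuousLinearEquiv, ?_⟩
  ext v w
  rfl

lemma differentiableAt_christoffel {G : E → E →L[ℝ] E →L[ℝ] ℝ} {y : E}
    (hG : ContDiffAt ℝ ∞ G y) (hy : (G y).IsInvertible) :
    DifferentiableAt ℝ (christoffel G) y := by
  have h₁ : DifferentiableAt ℝ (fun z => (G z).inverse) y :=
    ((hy.contDiffAt_map_inverse (n := ∞)).comp y hG).differentiableAt (by simp)
  have h₂ : DifferentiableAt ℝ (fderiv ℝ G) y :=
    (hG.fderiv_right (m := 1) (by norm_num; exact WithTop.coe_le_coe.2 le_top)).differentiableAt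
      (by simp)
  have h₃ : DifferentiableAt ℝ (fun z => koszul (fderiv ℝ G z)) y := by
    unfold koszul
    have hflip := (ContinuousLinearMap.flipₗᵢ ℝ E E
      (E →L[ℝ] ℝ)).toContinuousLinearEquiv.differentiableAt.comp y h₂
    exact ((h₂.add hflip).sub ((differentiableAt_const _).clm_comp hflip)).const_smul (1 / 2 : ℝ)
  exact ((ContinuousLinearMap.compL ℝ E (E →L[ℝ] ℝ) E).differentiableAt.comp y h₁).clm_comp h₃

/-- The Ricci tensor of a product metric is the sum of the Ricci tensors of the factors. -/
lemma ricciLocal_prod {G : E × E' → E × E' →L[ℝ] E × E' →L[ℝ] ℝ}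
    {G₁ : E → E →L[ℝ] E →L[ℝ] ℝ} {G₂ : E' → E' →L[ℝ] E' →L[ℝ] ℝ} {y : E × E'}
    {s : Set (E × E')} {s₁ : Set E} {s₂ : Set E'} (hs : IsOpen s) (hs₁ : IsOpen s₁)
    (hs₂ : IsOpen s₂) (h₁ : Set.MapsTo Prod.fst s s₁) (h₂ : Set.MapsTo Prod.snd s s₂)
    (h : ∀ z ∈ s, ∀ v w, G z v w = G₁ z.1 v.1 w.1 + G₂ z.2 v.2 w.2)
    (hG : ContDiffOn ℝ ∞ G s) (hG₁ : ContDiffOn ℝ ∞ G₁ s₁)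
    (hG₂ : ContDiffOn ℝ ∞ G₂ s₂) (hi : ∀ z ∈ s, (G z).IsInvertible)
    (hi₁ : ∀ z ∈ s₁, (G₁ z).IsInvertible) (hi₂ : ∀ z ∈ s₂, (G₂ z).IsInvertible)
    (hy : y ∈ s) (u v : E × E') :
    ricciLocal G y u v = ricciLocal G₁ y.1 u.1 v.1 + ricciLocal G₂ y.2 u.2 v.2 := by
  have c (z) (hz : z ∈ s) : ContDiffAt ℝ ∞ G z := hG.contDiffAt (hs.mem_nhds hz)
  have c₁ (z) (hz : z ∈ s₁) : ContDiffAt ℝ ∞ G₁ z := hG₁.contDiffAt (hs₁.mem_nhds hz)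
  have c₂ (z) (hz : z ∈ s₂) : ContDiffAt ℝ ∞ G₂ z := hG₂.contDiffAt (hs₂.mem_nhds hz)
  have hΓ : ∀ z ∈ s, ∀ v w, christoffel G z v w =
      (christoffel G₁ z.1 v.1 w.1, christoffel G₂ z.2 v.2 w.2) := fun z hz =>
    christoffel_prod ((hs.eventually_mem hz).mono h) ((c z hz).differentiableAt (by simp))
      ((c₁ _ (h₁ hz)).differentiableAt (by simp)) ((c₂ _ (h₂ hz)).differentiableAt (by simp))
      (hi z hz) (hi₁ _ (h₁ hz)) (hi₂ _ (h₂ hz))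
  have hD := fderiv_split (.inl ℝ E E') (.inr ℝ E E')
    (differentiableAt_christoffel (c y hy) (hi y hy))
    (differentiableAt_christoffel (c₁ _ (h₁ hy)) (hi₁ _ (h₁ hy)))
    (differentiableAt_christoffel (c₂ _ (h₂ hy)) (hi₂ _ (h₂ hy)))
    ((hs.eventually_mem hy).mono fun z hz v w => by simp [hΓ z hz])
  have hR : (curvature G y u v : E × E' →ₗ[ℝ] E × E') =
      LinearMap.prodMap (curvature G₁ y.1 u.1 v.1 : E →ₗ[ℝ] E)
        (curvature G₂ y.2 u.2 v.2 : E' →ₗ[ℝ] E') := by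
    refine LinearMap.ext fun w => ?_
    simp [curvature_apply, hD, hΓ y hy]
  rw [ricciLocal, hR, LinearMap.trace_prodMap']
  rfl

end LocalRicci

/-! ### The Ricci tensor of a product manifold -/

section ProductRicci

variable {E : Type*} [NormedAddCommGroup E] [NormedSpace ℝ E] [FiniteDimensional ℝ E]
  {H : Type*} [TopologicalSpace H] {I : ModelWithCorners ℝ E H}
  {M : Type*} [TopologicalSpace M] [ChartedSpace H M]
  {E' : Type*} [NormedAddCommGroup E'] [NormedSpace ℝ E'] [FiniteDimensional ℝ E']
  {H' : Type*} [TopologicalSpace H'] {J : ModelWithCorners ℝ E' H'}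
  {N : Type*} [TopologicalSpace N] [ChartedSpace H' N]
  [I.Boundaryless] [J.Boundaryless] [IsManifold I ∞ M] [IsManifold J ∞ N]

lemma isInvertible_localBilin (g : Metric I M) (x₀ : M) {y : E}
    (hy : y ∈ (extChartAt I x₀).target) : (localBilin g.inner x₀ y).IsInvertible := by
  have hf : (frame I x₀ y).IsInvertible := by
    have : IsManifold I 1 M := .of_le (n := ∞) (by simp)
    have h := isInvertible_mfderivWithin_extChartAt_symm hy
    rwa [I.range_eq_univ, mfderivWithin_univ] at h
  refine isInvertible_of_nondegenerate fun v hv => ?_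
  refine hf.injective ((g.nondegenerate _ _ fun w => ?_).trans (map_zero _).symm)
  obtain ⟨w, rfl⟩ := hf.surjective w
  exact hv w

/-- In the product chart at `p`, the product metric is a sum of metrics depending on separate
coordinates, so that `ricciLocal_prod` applies. -/
lemma ricci_prod (g₁ : Metric I M) (g₂ : Metric J N) (p : M × N)
    (X Y : TangentSpace (I.prod J) p) :
    (g₁.prod g₂).ricci p X Y =
      g₁.ricci p.1 (tangentFst I J p X) (tangentFst I J p Y) +
        g₂.ricci p.2 (tangentSnd I J p X) (tangentSnd I J p Y) := by
  have hd (Z : TangentSpace (I.prod J) p) :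
      mfderiv (I.prod J) 𝓘(ℝ, E × E') (extChartAt (I.prod J) p) p Z =
        (mfderiv I 𝓘(ℝ, E) (extChartAt I p.1) p.1 (tangentFst I J p Z),
          mfderiv J 𝓘(ℝ, E') (extChartAt J p.2) p.2 (tangentSnd I J p Z)) := by
    have k₁ := (mdifferentiableAt_extChartAt (I := I) (mem_chart_source H p.1)).hasMFDerivAt.comp p
      (mdifferentiableAt_fst (I := I) (I' := J) (x := p)).hasMFDerivAt
    have k₂ := (mdifferentiableAt_extChartAt (I := J) (mem_chart_source H' p.2)).hasMFDerivAt.comp p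
      (mdifferentiableAt_snd (I := I) (I' := J) (x := p)).hasMFDerivAt
    have k := HasMFDerivAt.mfderiv (I := I.prod J) (I' := 𝓘(ℝ, E × E'))
      ⟨k₁.1.prodMk k₂.1, k₁.2.prodMk k₂.2⟩
    have e : ⇑(extChartAt (I.prod J) p) =
        fun z => ((extChartAt I p.1 ∘ Prod.fst) z, (extChartAt J p.2 ∘ Prod.snd) z) := by
      rw [extChartAt_prod]; rfl
    rw [e]
    exact DFunLike.congr_fun k Z
  unfold Metric.ricci
  refine (ricciLocal_prod (isOpen_extChartAt_target p) (isOpen_extChartAt_target p.1)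
    (isOpen_extChartAt_target p.2) (mapsTo_fst p) (mapsTo_snd p) ?_
    ((g₁.prod g₂).smooth p) (g₁.smooth p.1) (g₂.smooth p.2)
    (fun _ => isInvertible_localBilin _ _) (fun _ => isInvertible_localBilin _ _)
    (fun _ => isInvertible_localBilin _ _) (mem_extChartAt_target p) _ _).trans ?_
  · intro z hz v w
    have e₁ : ∀ v, tangentFst I J _ (frame (I.prod J) p z v) = frame I p.1 z.1 v.1 :=
      fun v => by rw [frame_prod p z hz, tangentFst_apply]
    have e₂ : ∀ v, tangentSnd I J _ (frame (I.prod J) p z v) = frame J p.2 z.2 v.2 :=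
      fun v => by rw [frame_prod p z hz, tangentSnd_apply]
    exact congrArg₂ (· + ·)
      (congrArg₂ (fun a b => g₁.inner ((extChartAt I p.1).symm z.1) a b) (e₁ v) (e₁ w))
      (congrArg₂ (fun a b => g₂.inner ((extChartAt J p.2).symm z.2) a b) (e₂ v) (e₂ w))
  · have h₁ (Z) : (mfderiv (I.prod J) 𝓘(ℝ, E × E') (extChartAt (I.prod J) p) p Z : E × E').1 =
        mfderiv I 𝓘(ℝ, E) (extChartAt I p.1) p.1 (tangentFst I J p Z) := congrArg Prod.fst (hd Z)
    have h₂ (Z) : (mfderiv (I.prod J) 𝓘(ℝ, E × E') (extChartAt (I.prod J) p) p Z : E × E').2 =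
        mfderiv J 𝓘(ℝ, E') (extChartAt J p.2) p.2 (tangentSnd I J p Z) := congrArg Prod.snd (hd Z)
    exact congrArg₂ (· + ·)
      (congrArg₂ (ricciLocal (localBilin g₁.inner p.1) (extChartAt I p.1 p.1)) (h₁ X) (h₁ Y))
      (congrArg₂ (ricciLocal (localBilin g₂.inner p.2) (extChartAt J p.2 p.2)) (h₂ X) (h₂ Y))

end ProductRicci

/-! ### Forms of a given bidegree on a direct sum -/

section SplitForms

variable {V V₁ V₂ : Type*} [AddCommGroup V] [Module ℝ V] [AddCommGroup V₁] [Module ℝ V₁]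
  [AddCommGroup V₂] [Module ℝ V₂] (e : (V₁ × V₂) ≃ₗ[ℝ] V)

/-- For a splitting `V ≃ V₁ × V₂`, the vector of `V` given by a vector of one of the summands. -/
def pureVec : V₁ ⊕ V₂ → V :=
  Sum.elim (fun x => e (x, 0)) fun y => e (0, y)

/-- The positions at which a family with values in a disjoint union lies in the left part. -/
def leftSet {A B : Type*} {n : ℕ} (v : Fin n → A ⊕ B) : Finset (Fin n) :=
  {i | (v i).isLeft}

/-- A form on `V ≃ V₁ × V₂` has bidegree `(k, n - k)`: it vanishes on families of vectors of the
two summands, unless exactly `k` of them lie in `V₁`. -/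
def HasBidegree {n : ℕ} (ξ : V [⋀^Fin n]→ₗ[ℝ] ℝ) (k : ℕ) : Prop :=
  ∀ v : Fin n → V₁ ⊕ V₂, (leftSet v).card ≠ k → ξ (fun i => pureVec e (v i)) = 0

/-- A form on `V ≃ V₁ × V₂` represents `a ∧ b`: it has the bidegree of `a ∧ b`, and its value on
`x₁, …, x_k ∈ V₁`, `y₁, …, y_l ∈ V₂`, in this order, is `a(x₁, …, x_k) b(y₁, …, y_l)`. The degree
`n = k + l` is kept separate, to allow for degrees that are not syntactically sums. -/
structure IsTensor {n k l : ℕ} (h : k + l = n) (ξ : V [⋀^Fin n]→ₗ[ℝ] ℝ)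
    (a : V₁ [⋀^Fin k]→ₗ[ℝ] ℝ) (b : V₂ [⋀^Fin l]→ₗ[ℝ] ℝ) : Prop where
  bidegree : HasBidegree e ξ k
  apply_append : ∀ (x : Fin k → V₁) (y : Fin l → V₂),
    ξ (fun i => pureVec e (Fin.append (Sum.inl ∘ x) (Sum.inr ∘ y) (Fin.cast h.symm i))) = a x * b y

variable {e}

lemma leftSet_append {A B : Type*} {k l : ℕ} (x : Fin k → A) (y : Fin l → B) :
    leftSet (Fin.append (Sum.inl ∘ x) (Sum.inr ∘ y)) =
      ({i | (i : ℕ) < k} : Finset (Fin (k + l))) := by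
  ext i
  refine Fin.addCases (fun i => ?_) (fun i => ?_) i <;> simp [leftSet]

lemma exists_append_of_leftSet {A B : Type*} {k l : ℕ} (v : Fin (k + l) → A ⊕ B)
    (hv : leftSet v = ({i | (i : ℕ) < k} : Finset (Fin (k + l)))) :
    ∃ x y, Fin.append (Sum.inl ∘ x) (Sum.inr ∘ y) = v := by
  have h (i : Fin (k + l)) : (v i).isLeft = true ↔ (i : ℕ) < k := by
    simpa [leftSet] using Finset.ext_iff.1 hv i
  have h₁ (i : Fin k) : ∃ x, v (Fin.castAdd l i) = Sum.inl x :=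
    Sum.isLeft_iff.1 ((h _).2 (by simp))
  have h₂ (i : Fin l) : ∃ y, v (Fin.natAdd k i) = Sum.inr y := by
    rcases hv' : v (Fin.natAdd k i) with x | y
    · exact absurd ((h _).1 (by rw [hv']; rfl)) (by simp)
    · exact ⟨y, rfl⟩
  choose x hx using h₁
  choose y hy using h₂
  refine ⟨x, y, funext fun i => ?_⟩
  refine Fin.addCases (fun i => ?_) (fun i => ?_) i <;> simp [hx, hy]

lemma append_injective {A B : Type*} {k l : ℕ} :
    Function.Injective fun z : (Fin k → A) × (Fin l → B) =>
      (Fin.append (Sum.inl ∘ z.1) (Sum.inr ∘ z.2) : Fin (k + l) → A ⊕ B) := by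
  rintro ⟨x, y⟩ ⟨x', y'⟩ h
  refine Prod.ext (funext fun i => ?_) (funext fun i => ?_)
  · simpa using congrFun h (Fin.castAdd l i)
  · simpa using congrFun h (Fin.natAdd k i)

/-- Any two sets of `k` positions are related by a permutation of the positions. -/
lemma exists_perm_of_card_eq {n : ℕ} {s t : Finset (Fin n)} (h : s.card = t.card) :
    ∃ σ : Equiv.Perm (Fin n), ∀ i, σ i ∈ t ↔ i ∈ s := by
  classical
  have c : Fintype.card {i // i ∈ s} = Fintype.card {i // i ∈ t} := by simpa using h
  let f : {i // i ∈ s} ≃ {i // i ∈ t} := Fintype.equivOfCardEq c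
  refine ⟨f.extendSubtype, fun i => ?_⟩
  by_cases hi : i ∈ s
  · simp only [hi, iff_true]
    exact f.extendSubtype_mem i hi
  · simp only [hi, iff_false]
    exact f.extendSubtype_not_mem i hi

/-! ### Scalar products of forms on an orthogonal sum -/

lemma formInner_add_left [FiniteDimensional ℝ V] (h : LinearMap.BilinForm ℝ V) {k : ℕ}
    (α α' β : V [⋀^Fin k]→ₗ[ℝ] ℝ) :
    formInner h (α + α') β = formInner h α β + formInner h α' β := by
  simp [formInner, formInnerBasis, add_mul, Finset.sum_add_distrib, mul_add]

lemma formInner_add_right [FiniteDimensional ℝ V] (h : LinearMap.BilinForm ℝ V) {k : ℕ}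
    (α β β' : V [⋀^Fin k]→ₗ[ℝ] ℝ) :
    formInner h α (β + β') = formInner h α β + formInner h α β' := by
  simp [formInner, formInnerBasis, add_mul, Finset.sum_add_distrib, mul_add]

lemma formInner_smul_left [FiniteDimensional ℝ V] (h : LinearMap.BilinForm ℝ V) {k : ℕ}
    (c : ℝ) (α β : V [⋀^Fin k]→ₗ[ℝ] ℝ) : formInner h (c • α) β = c * formInner h α β := by
  simp only [formInner, formInnerBasis, AlternatingMap.smul_apply, smul_eq_mul, mul_assoc,
    ← Finset.mul_sum]
  ring

lemma formInner_smul_right [FiniteDimensional ℝ V] (h : LinearMap.BilinForm ℝ V) {k : ℕ}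
    (c : ℝ) (α β : V [⋀^Fin k]→ₗ[ℝ] ℝ) : formInner h α (c • β) = c * formInner h α β := by
  simp only [formInner, formInnerBasis, AlternatingMap.smul_apply, smul_eq_mul, mul_assoc,
    mul_left_comm _ c, ← Finset.mul_sum]

/-- The splitting is orthogonal for `h`, with restrictions `h₁` and `h₂`. -/
def IsOrthogonalSum (e : (V₁ × V₂) ≃ₗ[ℝ] V) (h : LinearMap.BilinForm ℝ V)
    (h₁ : LinearMap.BilinForm ℝ V₁) (h₂ : LinearMap.BilinForm ℝ V₂) : Prop :=
  ∀ v w, h (e v) (e w) = h₁ v.1 w.1 + h₂ v.2 w.2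

section Gram

variable {ι₁ ι₂ : Type*} [Fintype ι₁] [DecidableEq ι₁] [Fintype ι₂] [DecidableEq ι₂]
  (b₁ : Module.Basis ι₁ ℝ V₁) (b₂ : Module.Basis ι₂ ℝ V₂)
  {h : LinearMap.BilinForm ℝ V} {h₁ : LinearMap.BilinForm ℝ V₁} {h₂ : LinearMap.BilinForm ℝ V₂}

omit [Fintype ι₁] [DecidableEq ι₁] [Fintype ι₂] [DecidableEq ι₂] in
lemma prod_map_basis_apply (i : ι₁ ⊕ ι₂) :
    (b₁.prod b₂).map e i = pureVec e (i.map b₁ b₂) := by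
  rcases i with i | i <;> simp [pureVec]

lemma inv_toMatrix_prod (he : IsOrthogonalSum e h h₁ h₂) (n₁ : h₁.Nondegenerate)
    (n₂ : h₂.Nondegenerate) :
    (LinearMap.BilinForm.toMatrix ((b₁.prod b₂).map e) h)⁻¹ =
      Matrix.fromBlocks (LinearMap.BilinForm.toMatrix b₁ h₁)⁻¹ 0 0
        (LinearMap.BilinForm.toMatrix b₂ h₂)⁻¹ := by
  have hb : LinearMap.BilinForm.toMatrix ((b₁.prod b₂).map e) h =
      Matrix.fromBlocks (LinearMap.BilinForm.toMatrix b₁ h₁) 0 0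
        (LinearMap.BilinForm.toMatrix b₂ h₂) := by
    ext i j
    rw [LinearMap.BilinForm.toMatrix_apply, prod_map_basis_apply, prod_map_basis_apply]
    rcases i with i | i <;> rcases j with j | j <;>
      simp [pureVec, he _ _, LinearMap.BilinForm.toMatrix_apply]
  rw [hb]
  apply Matrix.inv_eq_left_inv
  rw [Matrix.fromBlocks_multiply,
    Matrix.nonsing_inv_mul _ ((LinearMap.BilinForm.nondegenerate_iff_det_ne_zero b₁).1 n₁).isUnit,
    Matrix.nonsing_inv_mul _ ((LinearMap.BilinForm.nondegenerate_iff_det_ne_zero b₂).1 n₂).isUnit]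
  simp

end Gram

section Inner

variable [FiniteDimensional ℝ V] [FiniteDimensional ℝ V₁] [FiniteDimensional ℝ V₂]
  {h : LinearMap.BilinForm ℝ V} {h₁ : LinearMap.BilinForm ℝ V₁} {h₂ : LinearMap.BilinForm ℝ V₂}

/-- The sum of a symmetric function of `n` indices that vanishes unless exactly `k` of them lie in
`A`, in terms of the families whose left positions form a given set of `k` elements. -/
lemma sum_eq_choose_mul {A B : Type*} [Fintype A] [Fintype B] {n k : ℕ}
    (f : (Fin n → A ⊕ B) → ℝ) (h₀ : ∀ v, (leftSet v).card ≠ k → f v = 0)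
    (hσ : ∀ (σ : Equiv.Perm (Fin n)) v, f (v ∘ σ) = f v) {s : Finset (Fin n)} (hs : s.card = k) :
    ∑ v, f v = n.choose k * ∑ v with leftSet v = s, f v := by
  classical
  have key : ∀ t ∈ Finset.powersetCard k (Finset.univ : Finset (Fin n)),
      ∑ v with leftSet v = t, f v = ∑ v with leftSet v = s, f v := by
    intro t ht
    obtain ⟨σ, hσ'⟩ := exists_perm_of_card_eq (hs.trans (Finset.mem_powersetCard.1 ht).2.symm)
    refine Finset.sum_equiv (σ.arrowCongr (Equiv.refl _)).symm (fun v => ?_) fun v _ => ?_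
    · simp only [Finset.mem_filter_univ, Finset.ext_iff]
      rw [← σ.forall_congr_right]
      refine forall_congr' fun i => ?_
      rw [hσ']
      simp [leftSet]
    · exact (hσ σ v).symm
  calc ∑ v, f v = ∑ t : Finset (Fin n), ∑ v with leftSet v = t, f v :=
        (Finset.sum_fiberwise _ _ _).symm
    _ = ∑ t ∈ Finset.powersetCard k Finset.univ, ∑ v with leftSet v = t, f v := by
        refine (Finset.sum_subset (Finset.subset_univ _) fun t _ ht => ?_).symm
        refine Finset.sum_eq_zero fun v hv => h₀ v fun hk => ht ?_
        rw [Finset.mem_powersetCard, ← (Finset.mem_filter_univ _).1 hv]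
        exact ⟨Finset.subset_univ _, hk⟩
    _ = _ := by
        rw [Finset.sum_congr rfl key]
        simp

lemma leftSet_map {A B A' B' : Type*} {n : ℕ} (f : A → A') (g : B → B') (v : Fin n → A ⊕ B) :
    leftSet (fun i => (v i).map f g) = leftSet v := by
  simp [leftSet]

lemma prod_fromBlocks_eq_zero {ι₁ ι₂ : Type*} (A : Matrix ι₁ ι₁ ℝ) (D : Matrix ι₂ ι₂ ℝ) {n : ℕ}
    {i j : Fin n → ι₁ ⊕ ι₂} (hij : leftSet i ≠ leftSet j) :
    ∏ m, Matrix.fromBlocks A 0 0 D (i m) (j m) = 0 := by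
  obtain ⟨m, hm⟩ : ∃ m, (i m).isLeft ≠ (j m).isLeft := by
    by_contra! hc
    exact hij (by simp [leftSet, hc])
  refine Finset.prod_eq_zero (Finset.mem_univ m) ?_
  rcases hi : i m with a | a <;> rcases hj : j m with b | b <;>
    first | rfl | exact absurd (by rw [hi, hj]; rfl) hm

/-- Forms of different bidegrees on an orthogonal sum are orthogonal: a term with multiindices `i`
and `j` contains an entry of the Gram matrix between the summands, unless `i` and `j` have the same
left positions. -/
lemma HasBidegree.formInner_eq_zero (he : IsOrthogonalSum e h h₁ h₂) (n : h.Nondegenerate)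
    (n₁ : h₁.Nondegenerate) (n₂ : h₂.Nondegenerate) {m k k' : ℕ} {ξ η : V [⋀^Fin m]→ₗ[ℝ] ℝ}
    (hξ : HasBidegree e ξ k) (hη : HasBidegree e η k') (hk : k ≠ k') : formInner h ξ η = 0 := by
  let b₁ := Module.finBasis ℝ V₁
  let b₂ := Module.finBasis ℝ V₂
  rw [formInner_eq ((b₁.prod b₂).map e) h n, formInnerBasis, inv_toMatrix_prod b₁ b₂ he n₁ n₂]
  refine mul_eq_zero_of_right _ (Finset.sum_eq_zero fun i _ => Finset.sum_eq_zero fun j _ => ?_)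
  by_cases hij : leftSet i = leftSet j
  · simp only [prod_map_basis_apply]
    by_cases hi : (leftSet i).card = k
    · rw [hη (fun m => (j m).map b₁ b₂) (by rw [leftSet_map, ← hij, hi]; exact hk)]
      ring
    · rw [hξ (fun m => (i m).map b₁ b₂) (by rwa [leftSet_map])]
      ring
  · rw [prod_fromBlocks_eq_zero _ _ hij, mul_zero]

/-- The scalar product of `a ∧ b` and `a' ∧ b'` on an orthogonal sum is `⟨a, a'⟩ ⟨b, b'⟩`. All
`(k + l).choose k` choices of the left positions contribute the same amount, and this number turns
the factor `1 / (k + l)!` into `1 / (k! l!)`. -/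
lemma IsTensor.formInner_eq_mul (he : IsOrthogonalSum e h h₁ h₂) (n : h.Nondegenerate)
    (n₁ : h₁.Nondegenerate) (n₂ : h₂.Nondegenerate) {m k l : ℕ} {hm : k + l = m}
    {ξ η : V [⋀^Fin m]→ₗ[ℝ] ℝ} {a a' : V₁ [⋀^Fin k]→ₗ[ℝ] ℝ} {b b' : V₂ [⋀^Fin l]→ₗ[ℝ] ℝ}
    (hξ : IsTensor e hm ξ a b) (hη : IsTensor e hm η a' b') :
    formInner h ξ η = formInner h₁ a a' * formInner h₂ b b' := by
  subst hm
  let b₁ := Module.finBasis ℝ V₁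
  let b₂ := Module.finBasis ℝ V₂
  rw [formInner_eq ((b₁.prod b₂).map e) h n, formInnerBasis, inv_toMatrix_prod b₁ b₂ he n₁ n₂,
    formInner, formInner, formInnerBasis, formInnerBasis]
  simp only [prod_map_basis_apply]
  set A := (LinearMap.BilinForm.toMatrix b₁ h₁)⁻¹
  set D := (LinearMap.BilinForm.toMatrix b₂ h₂)⁻¹
  rw [sum_eq_choose_mul (k := k) (s := {i | (i : ℕ) < k})]
  rotate_left
  · intro i hi
    refine Finset.sum_eq_zero fun j _ => ?_
    rw [hξ.bidegree (fun m => (i m).map b₁ b₂) (by rwa [leftSet_map])]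
    ring
  · intro σ i
    refine Fintype.sum_equiv (σ.arrowCongr (Equiv.refl _)) _ _ fun j => ?_
    have hj : j = (σ.arrowCongr (Equiv.refl _) j) ∘ σ := by ext; simp
    generalize σ.arrowCongr (Equiv.refl _) j = j' at hj ⊢
    subst hj
    have hH : ∏ m, Matrix.fromBlocks A 0 0 D (i (σ m)) (j' (σ m)) =
        ∏ m, Matrix.fromBlocks A 0 0 D (i m) (j' m) :=
      Equiv.prod_comp σ fun m => Matrix.fromBlocks A 0 0 D (i m) (j' m)
    have h₁ := ξ.map_perm (fun m => pureVec e ((i m).map b₁ b₂)) σ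
    have h₂ := η.map_perm (fun m => pureVec e ((j' m).map b₁ b₂)) σ
    simp only [Function.comp_def] at h₁ h₂ ⊢
    rw [h₁, h₂, hH, smul_mul_smul_comm, Int.units_mul_self, one_smul]
  · rw [Fin.card_filter_val_lt]
    simp
  -- only multiindices with the left entries first remain; these are the pairs `(x, y)`
  have happ (x : Fin k → Fin (Module.finrank ℝ V₁)) (y : Fin l → Fin (Module.finrank ℝ V₂)) :
      (fun m => (Fin.append (Sum.inl ∘ x) (Sum.inr ∘ y) m).map b₁ b₂) =
        Fin.append (Sum.inl ∘ b₁ ∘ x) (Sum.inr ∘ b₂ ∘ y) := by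
    funext i
    refine Fin.addCases (fun i => ?_) (fun i => ?_) i <;> simp
  have eξ (x : Fin k → Fin (Module.finrank ℝ V₁)) (y : Fin l → Fin (Module.finrank ℝ V₂)) :
      ξ (fun m => pureVec e ((Fin.append (Sum.inl ∘ x) (Sum.inr ∘ y) m).map b₁ b₂)) =
        a (b₁ ∘ x) * b (b₂ ∘ y) := by
    rw [← hξ.apply_append]
    exact congrArg (fun v => ξ (fun m => pureVec e (v m))) (happ x y)
  have eη (x : Fin k → Fin (Module.finrank ℝ V₁)) (y : Fin l → Fin (Module.finrank ℝ V₂)) :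
      η (fun m => pureVec e ((Fin.append (Sum.inl ∘ x) (Sum.inr ∘ y) m).map b₁ b₂)) =
        a' (b₁ ∘ x) * b' (b₂ ∘ y) := by
    rw [← hη.apply_append]
    exact congrArg (fun v => η (fun m => pureVec e (v m))) (happ x y)
  have hout (F : (Fin (k + l) → Fin (Module.finrank ℝ V₁) ⊕ Fin (Module.finrank ℝ V₂)) → ℝ)
      (hF : ∀ v, leftSet v ≠ ({i | (i : ℕ) < k} : Finset (Fin (k + l))) → F v = 0) :
      ∑ v, F v = ∑ z : (Fin k → Fin (Module.finrank ℝ V₁)) × (Fin l → Fin (Module.finrank ℝ V₂)),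
        F (Fin.append (Sum.inl ∘ z.1) (Sum.inr ∘ z.2)) := by
    refine (Fintype.sum_of_injective _ append_injective _ _ (fun v hv => hF v fun hv' => hv ?_)
      fun _ => rfl).symm
    obtain ⟨x, y, rfl⟩ := exists_append_of_leftSet v hv'
    exact ⟨(x, y), rfl⟩
  rw [Finset.sum_filter, hout _ fun v hv => if_neg hv]
  simp only [leftSet_append, if_true]
  have hin (x : Fin k → Fin (Module.finrank ℝ V₁)) (y : Fin l → Fin (Module.finrank ℝ V₂)) :=
    hout (fun v => ξ (fun m => pureVec e ((Fin.append (Sum.inl ∘ x) (Sum.inr ∘ y) m).map b₁ b₂)) *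
      η (fun m => pureVec e ((v m).map b₁ b₂)) *
      ∏ m, Matrix.fromBlocks A 0 0 D (Fin.append (Sum.inl ∘ x) (Sum.inr ∘ y) m) (v m))
      fun v hv => by
        rw [prod_fromBlocks_eq_zero _ _ (by rw [leftSet_append]; exact hv.symm), mul_zero]
  simp only [hin]
  simp only [eξ, eη, Fin.prod_univ_add, Fin.append_left, Fin.append_right, Function.comp_apply,
    Matrix.fromBlocks_apply₁₁, Matrix.fromBlocks_apply₂₂, Fintype.sum_prod_type]
  have hc : 1 / ((k + l).factorial : ℝ) * (k + l).choose k =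
      1 / (k.factorial : ℝ) * (1 / (l.factorial : ℝ)) := by
    have hf := congrArg (Nat.cast (R := ℝ)) (Nat.choose_mul_factorial_mul_factorial
      (Nat.le_add_right k l))
    rw [Nat.add_sub_cancel_left] at hf
    push_cast at hf
    rw [← hf]
    have : ((k + l).choose k : ℝ) ≠ 0 :=
      Nat.cast_ne_zero.2 (Nat.choose_pos (Nat.le_add_right k l)).ne'
    field_simp
  rw [← mul_assoc, hc, mul_mul_mul_comm, Finset.sum_mul_sum]
  congr 1
  refine Finset.sum_congr rfl fun x _ => Finset.sum_congr rfl fun y _ => ?_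
  rw [Finset.sum_mul_sum]
  refine Finset.sum_congr rfl fun x' _ => Finset.sum_congr rfl fun y' _ => ?_
  simp only [Function.comp_def]
  ring

end Inner

end SplitForms

/-! ### Wedge products and interior products on a direct sum -/

section WedgeForms

variable {V V₁ V₂ : Type*} [AddCommGroup V] [Module ℝ V] [AddCommGroup V₁] [Module ℝ V₁]
  [AddCommGroup V₂] [Module ℝ V₂] {e : (V₁ × V₂) ≃ₗ[ℝ] V}

/-- The first projection of a splitting `V ≃ V₁ × V₂`. -/
def splitFst (e : (V₁ × V₂) ≃ₗ[ℝ] V) : V →ₗ[ℝ] V₁ :=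
  LinearMap.fst ℝ V₁ V₂ ∘ₗ e.symm

/-- The second projection of a splitting `V ≃ V₁ × V₂`. -/
def splitSnd (e : (V₁ × V₂) ≃ₗ[ℝ] V) : V →ₗ[ℝ] V₂ :=
  LinearMap.snd ℝ V₁ V₂ ∘ₗ e.symm

@[simp] lemma splitFst_pureVec_inl (x : V₁) : splitFst e (pureVec e (Sum.inl x)) = x := by
  simp [splitFst, pureVec]

@[simp] lemma splitFst_pureVec_inr (y : V₂) : splitFst e (pureVec e (Sum.inr y)) = 0 := by
  simp [splitFst, pureVec]

@[simp] lemma splitSnd_pureVec_inl (x : V₁) : splitSnd e (pureVec e (Sum.inl x)) = 0 := by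
  simp [splitSnd, pureVec]

@[simp] lemma splitSnd_pureVec_inr (y : V₂) : splitSnd e (pureVec e (Sum.inr y)) = y := by
  simp [splitSnd, pureVec]

lemma compLinearMap_apply_eq_zero {W : Type*} [AddCommGroup W] [Module ℝ W] {k : ℕ}
    (a : W [⋀^Fin k]→ₗ[ℝ] ℝ) (f : V →ₗ[ℝ] W) {v : Fin k → V} (i : Fin k) (h : f (v i) = 0) :
    a.compLinearMap f v = 0 :=
  a.map_coord_zero i h

/-- The wedge product of forms pulled back from the summands: on vectors of the summands, in order,
only the trivial shuffle contributes. -/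
lemma isTensor_wedge {k l : ℕ} (a : V₁ [⋀^Fin k]→ₗ[ℝ] ℝ) (b : V₂ [⋀^Fin l]→ₗ[ℝ] ℝ) :
    IsTensor e rfl (wedge (a.compLinearMap (splitFst e)) (b.compLinearMap (splitSnd e))) a b where
  bidegree v hv := by
    rw [wedge_apply]
    refine Finset.sum_eq_zero fun σ _ => ?_
    induction σ using Quotient.inductionOn' with | _ σ
    simp only [AlternatingMap.domCoprod.summand_mk'', smul_apply,
      MultilinearMap.domDomCongr_apply, MultilinearMap.domCoprod_apply, map_zsmul_unit,
      LinearMap.mul'_apply]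
    refine smul_eq_zero_of_right _ ?_
    by_contra hne
    obtain ⟨ha, hb⟩ := mul_ne_zero_iff.1 hne
    -- a nonzero summand assigns the left vectors to `a` and the right ones to `b`
    have hl (i : Fin k) : (v (finSumFinEquiv (σ (Sum.inl i)))).isLeft := by
      rcases hi : v (finSumFinEquiv (σ (Sum.inl i))) with x | y
      · rfl
      · exact absurd (compLinearMap_apply_eq_zero _ _ i (by simp [hi])) ha
    have hr (i : Fin l) : (v (finSumFinEquiv (σ (Sum.inr i)))).isLeft = false := by
      rcases hi : v (finSumFinEquiv (σ (Sum.inr i))) with x | y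
      · exact absurd (compLinearMap_apply_eq_zero _ _ i (by simp [hi])) hb
      · rfl
    refine hv ?_
    have : leftSet v = Finset.univ.map
        ((Function.Embedding.inl.trans σ.toEmbedding).trans finSumFinEquiv.toEmbedding) := by
      ext m
      obtain ⟨i, rfl⟩ := (σ.trans finSumFinEquiv).surjective m
      rcases i with i | i <;> simp [leftSet, hl, hr]
    rw [this]
    simp
  apply_append x y := by
    rw [wedge_apply]
    refine (Finset.sum_eq_single (Quotient.mk'' 1 : Equiv.Perm.ModSumCongr (Fin k) (Fin l))
      ?_ ?_).trans ?_
    rotate_right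
    · simp only [AlternatingMap.domCoprod.summand_mk'', smul_apply,
        MultilinearMap.domDomCongr_apply, MultilinearMap.domCoprod_apply, map_zsmul_unit,
        LinearMap.mul'_apply]
      simp
    · intro σ _ hσ
      induction σ using Quotient.inductionOn' with | _ σ
      -- outside the trivial class, some vector of `V₂` is inserted into `a`
      obtain ⟨i, hi⟩ : ∃ i, (σ (Sum.inl i)).isLeft = false := by
        by_contra! hc
        refine hσ (Quotient.sound' ?_)
        rw [QuotientGroup.leftRel_apply, mul_one]
        refine inv_mem (Equiv.Perm.mem_sumCongrHom_range_of_perm_mapsTo_inl ?_)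
        rintro _ ⟨i, rfl⟩
        obtain ⟨j, hj⟩ := Sum.isLeft_iff.1 (Bool.eq_true_of_not_eq_false (hc i))
        exact ⟨j, hj.symm⟩
      obtain ⟨j, hj⟩ := Sum.isRight_iff.1 (Sum.isLeft_eq_false.1 hi)
      simp only [AlternatingMap.domCoprod.summand_mk'', smul_apply,
        MultilinearMap.domDomCongr_apply, MultilinearMap.domCoprod_apply, map_zsmul_unit,
        LinearMap.mul'_apply]
      refine smul_eq_zero_of_right _ (mul_eq_zero_of_left ?_ _)
      exact compLinearMap_apply_eq_zero _ _ i (by simp [hj])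
    · simp

/-- A form pulled back from the first summand is its product with the constant `0`-form `1`. -/
lemma isTensor_fst {k : ℕ} (a : V₁ [⋀^Fin k]→ₗ[ℝ] ℝ) :
    IsTensor e (Nat.add_zero k) (a.compLinearMap (splitFst e)) a
      (AlternatingMap.constOfIsEmpty ℝ V₂ (Fin 0) 1) where
  bidegree v hv := by
    obtain ⟨i, hi⟩ : ∃ i, (v i).isLeft = false := by
      by_contra! hc
      exact hv (by simp [leftSet, hc])
    obtain ⟨y, hy⟩ := Sum.isRight_iff.1 (Sum.isLeft_eq_false.1 hi)
    exact compLinearMap_apply_eq_zero _ _ i (by simp [hy])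
  apply_append x y := by
    have : (fun i => splitFst e (pureVec e (Fin.append (Sum.inl ∘ x) (Sum.inr ∘ y) i))) = x :=
      funext fun i => by
        rw [show i = Fin.castAdd 0 i from rfl, Fin.append_left]; simp
    simpa [AlternatingMap.compLinearMap_apply] using congrArg a this

/-- A form pulled back from the second summand is its product with the constant `0`-form `1`. -/
lemma isTensor_snd {l : ℕ} (b : V₂ [⋀^Fin l]→ₗ[ℝ] ℝ) :
    IsTensor e (Nat.zero_add l) (b.compLinearMap (splitSnd e))
      (AlternatingMap.constOfIsEmpty ℝ V₁ (Fin 0) 1) b where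
  bidegree v hv := by
    obtain ⟨i, hi⟩ : ∃ i, (v i).isLeft = true := by
      by_contra! hc
      exact hv (by simp [leftSet, hc])
    obtain ⟨y, hy⟩ := Sum.isLeft_iff.1 hi
    exact compLinearMap_apply_eq_zero _ _ i (by simp [hy])
  apply_append x y := by
    have : (fun i => splitSnd e (pureVec e (Fin.append (Sum.inl ∘ x) (Sum.inr ∘ y)
        (Fin.cast (Nat.zero_add l).symm i)))) = y :=
      funext fun i => by
        rw [show Fin.cast (Nat.zero_add l).symm i = Fin.natAdd 0 i by ext; simp, Fin.append_right]
        simp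
    simpa [AlternatingMap.compLinearMap_apply] using congrArg b this

lemma IsTensor.smul {n k l : ℕ} {h : k + l = n} {ξ : V [⋀^Fin n]→ₗ[ℝ] ℝ}
    {a : V₁ [⋀^Fin k]→ₗ[ℝ] ℝ} {b : V₂ [⋀^Fin l]→ₗ[ℝ] ℝ} (hξ : IsTensor e h ξ a b) (c : ℝ) :
    IsTensor e h (c • ξ) (c • a) b where
  bidegree v hv := by simp [hξ.bidegree v hv]
  apply_append x y := by simp [hξ.apply_append, mul_assoc]

lemma leftSet_cons_inl {A B : Type*} {n : ℕ} (x : A) (v : Fin n → A ⊕ B) :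
    (leftSet (Fin.cons (Sum.inl x) v : Fin (n + 1) → A ⊕ B)).card = (leftSet v).card + 1 := by
  simp only [leftSet, Fin.card_filter_univ_succ]
  simp [add_comm]

lemma leftSet_cons_inr {A B : Type*} {n : ℕ} (y : B) (v : Fin n → A ⊕ B) :
    (leftSet (Fin.cons (Sum.inr y) v : Fin (n + 1) → A ⊕ B)).card = (leftSet v).card := by
  simp only [leftSet, Fin.card_filter_univ_succ]
  simp

lemma interior_pureVec_apply {n : ℕ} (ξ : V [⋀^Fin (n + 1)]→ₗ[ℝ] ℝ) (z : V₁ ⊕ V₂)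
    (v : Fin n → V₁ ⊕ V₂) :
    interior (pureVec e z) ξ (fun i => pureVec e (v i)) =
      ξ (fun i => pureVec e ((Fin.cons z v : Fin (n + 1) → V₁ ⊕ V₂) i)) := by
  rw [interior, AlternatingMap.curryLeft_apply_apply]
  congr 1
  funext i
  refine Fin.cases rfl (fun i => rfl) i

/-- `X ⌟ (a ∧ b) = (X ⌟ a) ∧ b` for `X` in the first summand. -/
lemma IsTensor.interior_inl {n k l : ℕ} {h : k + 1 + l = n + 1} {ξ : V [⋀^Fin (n + 1)]→ₗ[ℝ] ℝ}
    {a : V₁ [⋀^Fin (k + 1)]→ₗ[ℝ] ℝ} {b : V₂ [⋀^Fin l]→ₗ[ℝ] ℝ} (hξ : IsTensor e h ξ a b) (X : V₁) :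
    IsTensor e (by omega) (interior (pureVec e (Sum.inl X)) ξ) (interior X a) b where
  bidegree v hv := by
    rw [interior_pureVec_apply]
    exact hξ.bidegree _ (by rw [leftSet_cons_inl]; omega)
  apply_append x y := by
    rw [interior_pureVec_apply, interior, AlternatingMap.curryLeft_apply_apply,
      ← hξ.apply_append]
    congr 1
    funext i
    congr 1
    obtain rfl : n = k + l := by omega
    have hc : (Sum.inl ∘ (Matrix.vecCons X x : Fin (k + 1) → V₁) : Fin (k + 1) → V₁ ⊕ V₂) =
        Fin.cons (Sum.inl X) (Sum.inl ∘ x) :=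
      funext fun i => Fin.cases rfl (fun i => rfl) i
    rw [hc, Fin.append_cons]
    rfl

/-- `Y ⌟ (a ∧ b) = (-1)^k a ∧ (Y ⌟ b)` for `Y` in the second summand, where `a` has degree `k`. -/
lemma IsTensor.interior_inr {n k l : ℕ} {h : k + (l + 1) = n + 1}
    {ξ : V [⋀^Fin (n + 1)]→ₗ[ℝ] ℝ} {a : V₁ [⋀^Fin k]→ₗ[ℝ] ℝ} {b : V₂ [⋀^Fin (l + 1)]→ₗ[ℝ] ℝ}
    (hξ : IsTensor e h ξ a b) (Y : V₂) :
    IsTensor e (by omega) (interior (pureVec e (Sum.inr Y)) ξ) ((-1 : ℝ) ^ k • a)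
      (interior Y b) where
  bidegree v hv := by
    rw [interior_pureVec_apply]
    exact hξ.bidegree _ (by rwa [leftSet_cons_inr])
  apply_append x y := by
    obtain rfl : n = k + l := by omega
    have hc : Fin.append (Sum.inl ∘ x) (Sum.inr ∘ (Matrix.vecCons Y y : Fin (l + 1) → V₂)) =
        (Fin.insertNth (n := k + l) (α := fun _ => V₁ ⊕ V₂) ⟨k, by omega⟩ (Sum.inr Y)
          (Fin.append (Sum.inl ∘ x) (Sum.inr ∘ y)) : Fin (k + l + 1) → V₁ ⊕ V₂) := by
      symm
      rw [Fin.insertNth_eq_iff]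
      constructor
      · exact (Fin.append_right (Sum.inl ∘ x)
          (Sum.inr ∘ (Matrix.vecCons Y y : Fin (l + 1) → V₂)) 0).symm
      · funext i
        rw [Fin.removeNth]
        refine Fin.addCases (fun i => ?_) (fun i => ?_) i
        · have hp : (⟨k, by omega⟩ : Fin (k + l + 1)).succAbove (Fin.castAdd l i) =
              Fin.castAdd (l + 1) i := by
            rw [Fin.succAbove_of_castSucc_lt _ _ (by simp [Fin.lt_def])]
            rfl
          rw [hp]
          exact (Fin.append_left _ _ i).trans (Fin.append_left (Sum.inl ∘ x)
            (Sum.inr ∘ (Matrix.vecCons Y y : Fin (l + 1) → V₂)) i).symm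
        · have hp : (⟨k, by omega⟩ : Fin (k + l + 1)).succAbove (Fin.natAdd k i) =
              Fin.natAdd k i.succ := by
            rw [Fin.succAbove_of_le_castSucc _ _ (by simp [Fin.le_def])]
            rfl
          rw [hp]
          exact (Fin.append_right _ _ i).trans (Fin.append_right (Sum.inl ∘ x)
            (Sum.inr ∘ (Matrix.vecCons Y y : Fin (l + 1) → V₂)) i.succ).symm
    -- moving `Y` behind `x₁, …, x_k` produces the sign
    have hs := ξ.map_insertNth (⟨k, by omega⟩ : Fin (k + l + 1)) (pureVec e (Sum.inr Y))
      fun i => pureVec e (Fin.append (Sum.inl ∘ x) (Sum.inr ∘ y) i)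
    have hv : (Fin.insertNth (n := k + l) (α := fun _ => V) ⟨k, by omega⟩ (pureVec e (Sum.inr Y))
        fun i => pureVec e (Fin.append (Sum.inl ∘ x) (Sum.inr ∘ y) i)) =
        fun i => pureVec e (Fin.append (Sum.inl ∘ x)
          (Sum.inr ∘ (Matrix.vecCons Y y : Fin (l + 1) → V₂)) i) := by
      rw [hc, Fin.insertNth_eq_iff]
      exact ⟨by simp, funext fun i => by simp [Fin.removeNth]⟩
    have hs' : a x * interior Y b y = (-1 : ℝ) ^ k * interior (pureVec e (Sum.inr Y)) ξ
        (fun i => pureVec e (Fin.append (Sum.inl ∘ x) (Sum.inr ∘ y) i)) := by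
      refine (hξ.apply_append x (Matrix.vecCons Y y)).symm.trans
        (((congrArg ξ hv).symm.trans hs).trans ?_)
      simp [interior]
    refine Eq.trans ?_ (congrArg ((-1 : ℝ) ^ k * ·) hs').symm |>.trans ?_
    · simp [← mul_assoc, ← mul_pow]
    · simp [mul_assoc]

lemma interior_inr_fst {k : ℕ} (a : V₁ [⋀^Fin (k + 1)]→ₗ[ℝ] ℝ) (Y : V₂) :
    interior (pureVec e (Sum.inr Y)) (a.compLinearMap (splitFst e)) = 0 := by
  ext v
  rw [interior, AlternatingMap.curryLeft_apply_apply]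
  exact compLinearMap_apply_eq_zero _ _ 0 (by simp)

lemma interior_inl_snd {k : ℕ} (b : V₂ [⋀^Fin (k + 1)]→ₗ[ℝ] ℝ) (X : V₁) :
    interior (pureVec e (Sum.inl X)) (b.compLinearMap (splitSnd e)) = 0 := by
  ext v
  rw [interior, AlternatingMap.curryLeft_apply_apply]
  exact compLinearMap_apply_eq_zero _ _ 0 (by simp)

end WedgeForms

/-! ### Contractions of a flux form at a point -/

section FluxAlgebra

variable {V V₁ V₂ : Type*} [AddCommGroup V] [Module ℝ V] [AddCommGroup V₁] [Module ℝ V₁]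
  [AddCommGroup V₂] [Module ℝ V₂]

lemma interior_add_left {k : ℕ} (X Y : V) (ξ : V [⋀^Fin (k + 1)]→ₗ[ℝ] ℝ) :
    interior (X + Y) ξ = interior X ξ + interior Y ξ :=
  map_add ξ.curryLeft X Y

lemma interior_add {k : ℕ} (X : V) (ξ η : V [⋀^Fin (k + 1)]→ₗ[ℝ] ℝ) :
    interior X (ξ + η) = interior X ξ + interior X η :=
  rfl

lemma interior_smul {k : ℕ} (X : V) (c : ℝ) (ξ : V [⋀^Fin (k + 1)]→ₗ[ℝ] ℝ) :
    interior X (c • ξ) = c • interior X ξ :=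
  rfl

lemma interior_apply_zero (X : V) (ξ : V [⋀^Fin 1]→ₗ[ℝ] ℝ) (v : Fin 0 → V) :
    interior X ξ v = ξ ![X] := by
  rw [interior, AlternatingMap.curryLeft_apply_apply]
  congr 1
  ext i
  fin_cases i
  rfl

@[simp] lemma interior_zero {k : ℕ} (X : V) : interior X (0 : V [⋀^Fin (k + 1)]→ₗ[ℝ] ℝ) = 0 :=
  rfl

@[simp] lemma wedge_zero {k l : ℕ} (a : V [⋀^Fin k]→ₗ[ℝ] ℝ) :
    wedge a (0 : V [⋀^Fin l]→ₗ[ℝ] ℝ) = 0 := by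
  ext v
  simp only [wedge, ← AlternatingMap.domCoprod'_apply, TensorProduct.tmul_zero, map_zero]
  simp

section Inner

variable [FiniteDimensional ℝ V]

@[simp] lemma formInner_zero_left (h : LinearMap.BilinForm ℝ V) {k : ℕ}
    (η : V [⋀^Fin k]→ₗ[ℝ] ℝ) : formInner h 0 η = 0 := by
  simp [formInner, formInnerBasis]

@[simp] lemma formInner_zero_right (h : LinearMap.BilinForm ℝ V) {k : ℕ}
    (ξ : V [⋀^Fin k]→ₗ[ℝ] ℝ) : formInner h ξ 0 = 0 := by
  simp [formInner, formInnerBasis]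

@[simp] lemma formNormSq_zero (h : LinearMap.BilinForm ℝ V) {k : ℕ} :
    formNormSq h (0 : V [⋀^Fin k]→ₗ[ℝ] ℝ) = 0 :=
  formInner_zero_left h 0

lemma formInner_comm (h : LinearMap.BilinForm ℝ V) (hs : ∀ v w, h v w = h w v) {k : ℕ}
    (ξ η : V [⋀^Fin k]→ₗ[ℝ] ℝ) : formInner h ξ η = formInner h η ξ := by
  set b := Module.finBasis ℝ V
  have hT : ((LinearMap.BilinForm.toMatrix b h)⁻¹).transpose =
      (LinearMap.BilinForm.toMatrix b h)⁻¹ := by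
    rw [Matrix.transpose_nonsing_inv]
    congr 1
    ext i j
    simp [LinearMap.BilinForm.toMatrix_apply, hs (b i)]
  rw [formInner, formInner, formInnerBasis, formInnerBasis, Finset.sum_comm]
  refine congrArg _ (Finset.sum_congr rfl fun i _ => Finset.sum_congr rfl fun j _ => ?_)
  rw [mul_comm (ξ _)]
  exact congrArg _ (Finset.prod_congr rfl fun m _ => congrFun (congrFun hT (i m)) (j m))

/-- On `0`-forms, i.e. constants, the scalar product is the product. -/
lemma formInner_zero_forms (h : LinearMap.BilinForm ℝ V) (ξ η : V [⋀^Fin 0]→ₗ[ℝ] ℝ) :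
    formInner h ξ η = ξ ![] * η ![] := by
  simp only [formInner, formInnerBasis, Finset.univ_unique, Finset.sum_singleton,
    Finset.univ_eq_empty, Finset.prod_empty, Nat.factorial_zero]
  simp only [Subsingleton.elim _ (![] : Fin 0 → V)]
  simp

end Inner

section FluxForm

variable {e : (V₁ × V₂) ≃ₗ[ℝ] V}

/-- The value at a point of a flux form: the general sum of products of forms on the factors. -/
def fluxForm (e : (V₁ × V₂) ≃ₗ[ℝ] V) (φ : ℝ) (α : V₁ [⋀^Fin 4]→ₗ[ℝ] ℝ)
    (β : V₁ [⋀^Fin 3]→ₗ[ℝ] ℝ) (ν : V₂ [⋀^Fin 1]→ₗ[ℝ] ℝ)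
    (γ : V₁ [⋀^Fin 2]→ₗ[ℝ] ℝ) (δ : V₂ [⋀^Fin 2]→ₗ[ℝ] ℝ)
    (ϖ : V₁ [⋀^Fin 1]→ₗ[ℝ] ℝ) (ε : V₂ [⋀^Fin 3]→ₗ[ℝ] ℝ)
    (ψ : ℝ) (θ : V₂ [⋀^Fin 4]→ₗ[ℝ] ℝ) : V [⋀^Fin 4]→ₗ[ℝ] ℝ :=
  φ • α.compLinearMap (splitFst e)
    + wedge (β.compLinearMap (splitFst e)) (ν.compLinearMap (splitSnd e))
    + wedge (γ.compLinearMap (splitFst e)) (δ.compLinearMap (splitSnd e))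
    + wedge (ϖ.compLinearMap (splitFst e)) (ε.compLinearMap (splitSnd e))
    + ψ • θ.compLinearMap (splitSnd e)

variable (φ : ℝ) (α : V₁ [⋀^Fin 4]→ₗ[ℝ] ℝ)
    (β : V₁ [⋀^Fin 3]→ₗ[ℝ] ℝ) (ν : V₂ [⋀^Fin 1]→ₗ[ℝ] ℝ)
    (γ : V₁ [⋀^Fin 2]→ₗ[ℝ] ℝ) (δ : V₂ [⋀^Fin 2]→ₗ[ℝ] ℝ)
    (ϖ : V₁ [⋀^Fin 1]→ₗ[ℝ] ℝ) (ε : V₂ [⋀^Fin 3]→ₗ[ℝ] ℝ)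
    (ψ : ℝ) (θ : V₂ [⋀^Fin 4]→ₗ[ℝ] ℝ)

/-- For `X` in the second summand the first term of the flux form drops out, and the contractions of
the others have the bidegrees `(3, 0)`, `(2, 1)`, `(1, 2)` and `(0, 3)`. -/
lemma interior_inr_fluxForm (X : V₂) :
    interior (k := 3) (pureVec e (Sum.inr X)) (fluxForm e φ α β ν γ δ ϖ ε ψ θ) =
      interior (k := 3) (pureVec e (Sum.inr X))
          (wedge (β.compLinearMap (splitFst e)) (ν.compLinearMap (splitSnd e)))
        + interior (k := 3) (pureVec e (Sum.inr X))
          (wedge (k := 2) (l := 2) (γ.compLinearMap (splitFst e)) (δ.compLinearMap (splitSnd e)))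
        + interior (k := 3) (pureVec e (Sum.inr X))
          (wedge (k := 1) (l := 3) (ϖ.compLinearMap (splitFst e)) (ε.compLinearMap (splitSnd e)))
        + interior (k := 3) (pureVec e (Sum.inr X)) (ψ • θ.compLinearMap (splitSnd e)) := by
  have h₀ : interior (k := 3) (pureVec e (Sum.inr X)) (φ • α.compLinearMap (splitFst e)) = 0 := by
    rw [interior_smul, interior_inr_fst, smul_zero]
  rw [fluxForm, interior_add, interior_add, interior_add, interior_add, h₀, zero_add]

/-- For `Y` in the first summand the last term of the flux form drops out, and the contractions of
the others have the bidegrees `(3, 0)`, `(2, 1)`, `(1, 2)` and `(0, 3)`. -/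
lemma interior_inl_fluxForm (Y : V₁) :
    interior (k := 3) (pureVec e (Sum.inl Y)) (fluxForm e φ α β ν γ δ ϖ ε ψ θ) =
      interior (k := 3) (pureVec e (Sum.inl Y)) (φ • α.compLinearMap (splitFst e))
        + interior (k := 3) (pureVec e (Sum.inl Y))
          (wedge (β.compLinearMap (splitFst e)) (ν.compLinearMap (splitSnd e)))
        + interior (k := 3) (pureVec e (Sum.inl Y))
          (wedge (k := 2) (l := 2) (γ.compLinearMap (splitFst e)) (δ.compLinearMap (splitSnd e)))
        + interior (k := 3) (pureVec e (Sum.inl Y))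
          (wedge (k := 1) (l := 3) (ϖ.compLinearMap (splitFst e))
            (ε.compLinearMap (splitSnd e))) := by
  have h₀ : interior (k := 3) (pureVec e (Sum.inl Y)) (ψ • θ.compLinearMap (splitSnd e)) = 0 := by
    rw [interior_smul, interior_inl_snd, smul_zero]
  rw [fluxForm, interior_add, interior_add, interior_add, interior_add, h₀, add_zero]

end FluxForm

section Orthogonal

variable [FiniteDimensional ℝ V] [FiniteDimensional ℝ V₁] [FiniteDimensional ℝ V₂]
  {e : (V₁ × V₂) ≃ₗ[ℝ] V} {h : LinearMap.BilinForm ℝ V} {h₁ : LinearMap.BilinForm ℝ V₁}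
  {h₂ : LinearMap.BilinForm ℝ V₂}

/-- The scalar product of two sums of forms of distinct bidegrees has no mixed terms. -/
lemma formInner_sum_of_hasBidegree (he : IsOrthogonalSum e h h₁ h₂) (n : h.Nondegenerate)
    (n₁ : h₁.Nondegenerate) (n₂ : h₂.Nondegenerate) {m r : ℕ} (ξ η : Fin r → V [⋀^Fin m]→ₗ[ℝ] ℝ)
    (d : Fin r → ℕ) (hd : Function.Injective d) (hξ : ∀ i, HasBidegree e (ξ i) (d i))
    (hη : ∀ i, HasBidegree e (η i) (d i)) :
    formInner h (∑ i, ξ i) (∑ i, η i) = ∑ i, formInner h (ξ i) (η i) := by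
  have hl (s : Finset (Fin r)) (ζ : V [⋀^Fin m]→ₗ[ℝ] ℝ) :
      formInner h (∑ i ∈ s, ξ i) ζ = ∑ i ∈ s, formInner h (ξ i) ζ :=
    map_sum (AddMonoidHom.mk' (fun ξ => formInner h ξ ζ)
      fun ξ ξ' => formInner_add_left h ξ ξ' ζ) ξ s
  have hr (s : Finset (Fin r)) (ζ : V [⋀^Fin m]→ₗ[ℝ] ℝ) :
      formInner h ζ (∑ i ∈ s, η i) = ∑ i ∈ s, formInner h ζ (η i) :=
    map_sum (AddMonoidHom.mk' (fun η => formInner h ζ η) (formInner_add_right h ζ)) η s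
  rw [hl]
  refine Finset.sum_congr rfl fun i _ => ?_
  rw [hr]
  exact Finset.sum_eq_single i (fun j _ hj => (hξ i).formInner_eq_zero he n n₁ n₂ (hη j)
    (hd.ne hj.symm)) (by simp)

/-- The scalar product of two sums of four products of forms, of total degree `3`. -/
lemma formInner_three_forms (he : IsOrthogonalSum e h h₁ h₂) (n : h.Nondegenerate)
    (n₁ : h₁.Nondegenerate) (n₂ : h₂.Nondegenerate)
    {ξ₀ ξ₁ ξ₂ ξ₃ η₀ η₁ η₂ η₃ : V [⋀^Fin 3]→ₗ[ℝ] ℝ}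
    {a₀ a₀' : V₁ [⋀^Fin 3]→ₗ[ℝ] ℝ} {b₀ b₀' : V₂ [⋀^Fin 0]→ₗ[ℝ] ℝ}
    {a₁ a₁' : V₁ [⋀^Fin 2]→ₗ[ℝ] ℝ} {b₁ b₁' : V₂ [⋀^Fin 1]→ₗ[ℝ] ℝ}
    {a₂ a₂' : V₁ [⋀^Fin 1]→ₗ[ℝ] ℝ} {b₂ b₂' : V₂ [⋀^Fin 2]→ₗ[ℝ] ℝ}
    {a₃ a₃' : V₁ [⋀^Fin 0]→ₗ[ℝ] ℝ} {b₃ b₃' : V₂ [⋀^Fin 3]→ₗ[ℝ] ℝ}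
    (t₀ : IsTensor e (by rfl) ξ₀ a₀ b₀) (t₁ : IsTensor e (by rfl) ξ₁ a₁ b₁)
    (t₂ : IsTensor e (by rfl) ξ₂ a₂ b₂) (t₃ : IsTensor e (by rfl) ξ₃ a₃ b₃)
    (t₀' : IsTensor e (by rfl) η₀ a₀' b₀') (t₁' : IsTensor e (by rfl) η₁ a₁' b₁')
    (t₂' : IsTensor e (by rfl) η₂ a₂' b₂') (t₃' : IsTensor e (by rfl) η₃ a₃' b₃') :
    formInner h (ξ₀ + ξ₁ + ξ₂ + ξ₃) (η₀ + η₁ + η₂ + η₃) =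
      formInner h₁ a₀ a₀' * formInner h₂ b₀ b₀' + formInner h₁ a₁ a₁' * formInner h₂ b₁ b₁'
        + formInner h₁ a₂ a₂' * formInner h₂ b₂ b₂'
        + formInner h₁ a₃ a₃' * formInner h₂ b₃ b₃' := by
  have key := formInner_sum_of_hasBidegree he n n₁ n₂ ![ξ₀, ξ₁, ξ₂, ξ₃] ![η₀, η₁, η₂, η₃]
    ![3, 2, 1, 0] (by decide)
    (by simpa [Fin.forall_fin_succ] using
      ⟨t₀.bidegree, t₁.bidegree, t₂.bidegree, t₃.bidegree⟩)
    (by simpa [Fin.forall_fin_succ] using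
      ⟨t₀'.bidegree, t₁'.bidegree, t₂'.bidegree, t₃'.bidegree⟩)
  simpa only [Fin.sum_univ_four, Matrix.cons_val, t₀.formInner_eq_mul he n n₁ n₂ t₀',
    t₁.formInner_eq_mul he n n₁ n₂ t₁', t₂.formInner_eq_mul he n n₁ n₂ t₂',
    t₃.formInner_eq_mul he n n₁ n₂ t₃'] using key

variable (φ : ℝ) (α : V₁ [⋀^Fin 4]→ₗ[ℝ] ℝ)
    (β : V₁ [⋀^Fin 3]→ₗ[ℝ] ℝ) (ν : V₂ [⋀^Fin 1]→ₗ[ℝ] ℝ)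
    (γ : V₁ [⋀^Fin 2]→ₗ[ℝ] ℝ) (δ : V₂ [⋀^Fin 2]→ₗ[ℝ] ℝ)
    (ϖ : V₁ [⋀^Fin 1]→ₗ[ℝ] ℝ) (ε : V₂ [⋀^Fin 3]→ₗ[ℝ] ℝ)
    (ψ : ℝ) (θ : V₂ [⋀^Fin 4]→ₗ[ℝ] ℝ)

lemma formNormSq_fluxForm (he : IsOrthogonalSum e h h₁ h₂) (n : h.Nondegenerate)
    (n₁ : h₁.Nondegenerate) (n₂ : h₂.Nondegenerate) :
    formNormSq h (fluxForm e φ α β ν γ δ ϖ ε ψ θ) =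
      φ ^ 2 * formNormSq h₁ α + formNormSq h₁ β * formNormSq h₂ ν
        + formNormSq h₁ γ * formNormSq h₂ δ + formNormSq h₁ ϖ * formNormSq h₂ ε
        + ψ ^ 2 * formNormSq h₂ θ := by
  have t₀ := (isTensor_fst (e := e) α).smul φ
  have t₁ := isTensor_wedge (e := e) β ν
  have t₂ := isTensor_wedge (e := e) γ δ
  have t₃ := isTensor_wedge (e := e) ϖ ε
  have t₄ := (isTensor_snd (e := e) θ).smul ψ
  have ht := And.intro t₀.bidegree (And.intro t₁.bidegree (And.intro t₂.bidegree
    (And.intro t₃.bidegree t₄.bidegree)))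
  have key := formInner_sum_of_hasBidegree he n n₁ n₂
    ![φ • α.compLinearMap (splitFst e),
      wedge (β.compLinearMap (splitFst e)) (ν.compLinearMap (splitSnd e)),
      wedge (γ.compLinearMap (splitFst e)) (δ.compLinearMap (splitSnd e)),
      wedge (ϖ.compLinearMap (splitFst e)) (ε.compLinearMap (splitSnd e)),
      ψ • θ.compLinearMap (splitSnd e)]
    ![φ • α.compLinearMap (splitFst e),
      wedge (β.compLinearMap (splitFst e)) (ν.compLinearMap (splitSnd e)),
      wedge (γ.compLinearMap (splitFst e)) (δ.compLinearMap (splitSnd e)),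
      wedge (ϖ.compLinearMap (splitFst e)) (ε.compLinearMap (splitSnd e)),
      ψ • θ.compLinearMap (splitSnd e)]
    ![4, 3, 2, 1, 0] (by decide) (by simpa [Fin.forall_fin_succ] using ht)
    (by simpa [Fin.forall_fin_succ] using ht)
  simp only [Fin.sum_univ_five, Matrix.cons_val, t₀.formInner_eq_mul he n n₁ n₂ t₀,
    t₁.formInner_eq_mul he n n₁ n₂ t₁, t₂.formInner_eq_mul he n n₁ n₂ t₂,
    t₃.formInner_eq_mul he n n₁ n₂ t₃, t₄.formInner_eq_mul he n n₁ n₂ t₄, formInner_smul_left,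
    formInner_smul_right] at key
  refine key.trans ?_
  simp only [formNormSq, formInner_zero_forms, AlternatingMap.constOfIsEmpty_apply]
  simp
  ring

lemma formInner_interior_inr_inr_fluxForm (he : IsOrthogonalSum e h h₁ h₂) (n : h.Nondegenerate)
    (n₁ : h₁.Nondegenerate) (n₂ : h₂.Nondegenerate) (X Y : V₂) :
    formInner h (interior (pureVec e (Sum.inr X)) (fluxForm e φ α β ν γ δ ϖ ε ψ θ))
        (interior (pureVec e (Sum.inr Y)) (fluxForm e φ α β ν γ δ ϖ ε ψ θ)) =
      formNormSq h₁ β * (ν ![X] * ν ![Y])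
        + formNormSq h₁ γ * formInner h₂ (interior X δ) (interior Y δ)
        + formNormSq h₁ ϖ * formInner h₂ (interior X ε) (interior Y ε)
        + ψ ^ 2 * formInner h₂ (interior X θ) (interior Y θ) := by
  rw [interior_inr_fluxForm, interior_inr_fluxForm]
  refine (formInner_three_forms he n n₁ n₂ ((isTensor_wedge β ν).interior_inr X)
    ((isTensor_wedge γ δ).interior_inr X) ((isTensor_wedge ϖ ε).interior_inr X)
    (((isTensor_snd θ).smul ψ).interior_inr X) ((isTensor_wedge β ν).interior_inr Y)
    ((isTensor_wedge γ δ).interior_inr Y) ((isTensor_wedge ϖ ε).interior_inr Y)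
    (((isTensor_snd θ).smul ψ).interior_inr Y)).trans ?_
  simp only [formInner_smul_left, formInner_smul_right, formInner_zero_forms,
    interior_apply_zero, formNormSq]
  simp
  ring

lemma formInner_interior_inl_inl_fluxForm (he : IsOrthogonalSum e h h₁ h₂) (n : h.Nondegenerate)
    (n₁ : h₁.Nondegenerate) (n₂ : h₂.Nondegenerate) (X Y : V₁) :
    formInner h (interior (pureVec e (Sum.inl X)) (fluxForm e φ α β ν γ δ ϖ ε ψ θ))
        (interior (pureVec e (Sum.inl Y)) (fluxForm e φ α β ν γ δ ϖ ε ψ θ)) =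
      φ ^ 2 * formInner h₁ (interior X α) (interior Y α)
        + formInner h₁ (interior X β) (interior Y β) * formNormSq h₂ ν
        + formInner h₁ (interior X γ) (interior Y γ) * formNormSq h₂ δ
        + ϖ ![X] * ϖ ![Y] * formNormSq h₂ ε := by
  rw [interior_inl_fluxForm, interior_inl_fluxForm]
  refine (formInner_three_forms he n n₁ n₂ (((isTensor_fst α).smul φ).interior_inl X)
    ((isTensor_wedge β ν).interior_inl X)
    ((isTensor_wedge γ δ).interior_inl X) ((isTensor_wedge ϖ ε).interior_inl X)
    (((isTensor_fst α).smul φ).interior_inl Y) ((isTensor_wedge β ν).interior_inl Y)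
    ((isTensor_wedge γ δ).interior_inl Y) ((isTensor_wedge ϖ ε).interior_inl Y)).trans ?_
  simp only [interior_smul, formInner_smul_left, formInner_smul_right, formInner_zero_forms,
    interior_apply_zero, AlternatingMap.constOfIsEmpty_apply, formNormSq]
  simp
  ring

/-- In the mixed contraction the components of `F` are paired with their neighbours: `X ⌟ F` and
`Y ⌟ F` have parts of the same bidegree that come from consecutive terms of `F`. The signs are those
of `IsTensor.interior_inr`. -/
lemma formInner_interior_inr_inl_fluxForm (he : IsOrthogonalSum e h h₁ h₂) (n : h.Nondegenerate)
    (n₁ : h₁.Nondegenerate) (n₂ : h₂.Nondegenerate) (X : V₂) (Y : V₁) :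
    formInner h (interior (pureVec e (Sum.inr X)) (fluxForm e φ α β ν γ δ ϖ ε ψ θ))
        (interior (pureVec e (Sum.inl Y)) (fluxForm e φ α β ν γ δ ϖ ε ψ θ)) =
      -(φ * ν ![X] * formInner h₁ β (interior Y α)
        - formInner h₁ γ (interior Y β) * formInner h₂ (interior X δ) ν
        + formInner h₁ ϖ (interior Y γ) * formInner h₂ (interior X ε) δ
        - ψ * ϖ ![Y] * formInner h₂ (interior X θ) ε) := by
  rw [interior_inr_fluxForm, interior_inl_fluxForm]
  refine (formInner_three_forms he n n₁ n₂ ((isTensor_wedge β ν).interior_inr X)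
    ((isTensor_wedge γ δ).interior_inr X) ((isTensor_wedge ϖ ε).interior_inr X)
    (((isTensor_snd θ).smul ψ).interior_inr X) (((isTensor_fst α).smul φ).interior_inl Y)
    ((isTensor_wedge β ν).interior_inl Y)
    ((isTensor_wedge γ δ).interior_inl Y) ((isTensor_wedge ϖ ε).interior_inl Y)).trans ?_
  simp only [interior_smul, formInner_smul_left, formInner_smul_right, formInner_zero_forms,
    interior_apply_zero, AlternatingMap.constOfIsEmpty_apply]
  simp
  ring

end Orthogonal

end FluxAlgebra

/-! ### The Einstein equation on a product manifold -/

section ProductEinstein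

lemma Metric.bilin_nondegenerate {E : Type*} [NormedAddCommGroup E] [NormedSpace ℝ E]
    {H : Type*} [TopologicalSpace H] {I : ModelWithCorners ℝ E H}
    {M : Type*} [TopologicalSpace M] [ChartedSpace H M] (g : Metric I M) (x : M) :
    (g.bilin x).Nondegenerate :=
  ⟨fun v hv => g.nondegenerate x v hv,
    fun v hv => g.nondegenerate x v fun w => (g.symm x v w).trans (hv w)⟩

variable {E : Type*} [NormedAddCommGroup E] [NormedSpace ℝ E]
  {H : Type*} [TopologicalSpace H] {I : ModelWithCorners ℝ E H}
  {M : Type*} [TopologicalSpace M] [ChartedSpace H M]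
  {E' : Type*} [NormedAddCommGroup E'] [NormedSpace ℝ E']
  {H' : Type*} [TopologicalSpace H'] {J : ModelWithCorners ℝ E' H'}
  {N : Type*} [TopologicalSpace N] [ChartedSpace H' N]

lemma ricci_zero_left (g : Metric I M) (x : M) (Y : TangentSpace I x) : g.ricci x 0 Y = 0 := by
  have h (G : E → E →L[ℝ] E →L[ℝ] ℝ) (y v : E) : ricciLocal G y 0 v = 0 := by
    have : curvature G y 0 v = 0 := by ext w; simp [curvature_apply]
    simp [ricciLocal, this]
  rw [Metric.ricci, map_zero]
  exact h _ _ _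

lemma ricci_zero_right (g : Metric I M) (x : M) (Y : TangentSpace I x) : g.ricci x Y 0 = 0 := by
  have h (G : E → E →L[ℝ] E →L[ℝ] ℝ) (y v : E) : ricciLocal G y v 0 = 0 := by
    have : curvature G y v 0 = 0 := by ext w; simp [curvature_apply]
    simp [ricciLocal, this]
  rw [Metric.ricci, map_zero]
  exact h _ _ _

variable (I J) in
/-- The splitting `T_x M × T_y N ≃ T_{(x, y)} (M × N)`. -/
def tangentSplit (p : M × N) :
    (TangentSpace I p.1 × TangentSpace J p.2) ≃ₗ[ℝ] TangentSpace (I.prod J) p :=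
  LinearEquiv.ofLinearMap
    (LinearMap.coprod (tangentInl I J p : TangentSpace I p.1 →ₗ[ℝ] TangentSpace (I.prod J) p)
      (tangentInr I J p : TangentSpace J p.2 →ₗ[ℝ] TangentSpace (I.prod J) p))
    (LinearMap.prod (tangentFst I J p : TangentSpace (I.prod J) p →ₗ[ℝ] TangentSpace I p.1)
      (tangentSnd I J p : TangentSpace (I.prod J) p →ₗ[ℝ] TangentSpace J p.2))
    (by
      refine LinearMap.ext fun v => ?_
      set w := tangentInl I J p (tangentFst I J p v) + tangentInr I J p (tangentSnd I J p v) with hw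
      have h₁ : tangentFst I J p w = tangentFst I J p v := by simp [hw, fst_inl, fst_inr]
      have h₂ : tangentSnd I J p w = tangentSnd I J p v := by simp [hw, snd_inl, snd_inr]
      exact Prod.ext
        ((tangentFst_apply p w).symm.trans (h₁.trans (tangentFst_apply p v)))
        ((tangentSnd_apply p w).symm.trans (h₂.trans (tangentSnd_apply p v))))
    (by
      refine LinearMap.ext fun v => ?_
      refine Prod.ext ?_ ?_
      · simp [fst_inl, fst_inr]
      · simp [snd_inl, snd_inr])

lemma tangentSplit_apply (p : M × N) (v : TangentSpace I p.1 × TangentSpace J p.2) :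
    tangentSplit I J p v = tangentInl I J p v.1 + tangentInr I J p v.2 := rfl

lemma pureVec_tangentSplit_inl (p : M × N) (X : TangentSpace I p.1) :
    pureVec (tangentSplit I J p) (Sum.inl X) = tangentInl I J p X := by
  simp [pureVec, tangentSplit_apply]

lemma pureVec_tangentSplit_inr (p : M × N) (X : TangentSpace J p.2) :
    pureVec (tangentSplit I J p) (Sum.inr X) = tangentInr I J p X := by
  simp [pureVec, tangentSplit_apply]

lemma exists_eq_inl_add_inr (p : M × N) (X : TangentSpace (I.prod J) p) :
    ∃ X₁ X₂, X = tangentInl I J p X₁ + tangentInr I J p X₂ :=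
  ⟨_, _, ((tangentSplit I J p).apply_symm_apply X).symm⟩

variable [I.Boundaryless] [J.Boundaryless] [IsManifold I ∞ M] [IsManifold J ∞ N]

lemma Metric.prod_inner (g₁ : Metric I M) (g₂ : Metric J N) (p : M × N)
    (X Y : TangentSpace (I.prod J) p) :
    (g₁.prod g₂).inner p X Y =
      g₁.inner p.1 (tangentFst I J p X) (tangentFst I J p Y) +
        g₂.inner p.2 (tangentSnd I J p X) (tangentSnd I J p Y) :=
  rfl

lemma isOrthogonalSum_tangentSplit (g₁ : Metric I M) (g₂ : Metric J N) (p : M × N) :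
    IsOrthogonalSum (tangentSplit I J p) ((g₁.prod g₂).bilin p) (g₁.bilin p.1)
      (g₂.bilin p.2) := by
  intro v w
  refine (g₁.prod_inner g₂ p _ _).trans ?_
  simp only [tangentSplit_apply, map_add, fst_inl, fst_inr, snd_inl, snd_inr, add_zero, zero_add]
  rfl

variable [FiniteDimensional ℝ E] [FiniteDimensional ℝ E']

lemma ricci₁₁_eq (g₁ : Metric I M) (g₂ : Metric J N) (p : M × N) (X Y : TangentSpace I p.1) :
    ricci₁₁ g₁ g₂ p X Y = g₁.ricci p.1 X Y := by
  rw [ricci₁₁, ricci_prod, fst_inl, fst_inl, snd_inl, snd_inl, ricci_zero_left, add_zero]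

lemma ricci₂₂_eq (g₁ : Metric I M) (g₂ : Metric J N) (p : M × N) (X Y : TangentSpace J p.2) :
    ricci₂₂ g₁ g₂ p X Y = g₂.ricci p.2 X Y := by
  rw [ricci₂₂, ricci_prod, fst_inr, fst_inr, snd_inr, snd_inr, ricci_zero_left, zero_add]

lemma ricci₂₁_eq_zero (g₁ : Metric I M) (g₂ : Metric J N) (p : M × N) (X : TangentSpace J p.2)
    (Y : TangentSpace I p.1) : ricci₂₁ g₁ g₂ p X Y = 0 := by
  rw [ricci₂₁, ricci_prod, fst_inl, fst_inr, snd_inl, snd_inr, ricci_zero_left, ricci_zero_right,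
    zero_add]

/-- The supergravity Einstein equation for a flux form, in terms of the factors. The components of
`F` may be arbitrary families of forms on the tangent spaces of the factors, so that components can
be taken to be zero, or constant functions. -/
lemma einsteinEquation_prod_iff (g₁ : Metric I M) (g₂ : Metric J N)
    (F : Form (I.prod J) (M × N) 4) (φ : M × N → ℝ)
    (α : ∀ p : M × N, TangentSpace I p.1 [⋀^Fin 4]→ₗ[ℝ] ℝ)
    (β : ∀ p : M × N, TangentSpace I p.1 [⋀^Fin 3]→ₗ[ℝ] ℝ)
    (ν : ∀ p : M × N, TangentSpace J p.2 [⋀^Fin 1]→ₗ[ℝ] ℝ)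
    (γ : ∀ p : M × N, TangentSpace I p.1 [⋀^Fin 2]→ₗ[ℝ] ℝ)
    (δ : ∀ p : M × N, TangentSpace J p.2 [⋀^Fin 2]→ₗ[ℝ] ℝ)
    (ϖ : ∀ p : M × N, TangentSpace I p.1 [⋀^Fin 1]→ₗ[ℝ] ℝ)
    (ε : ∀ p : M × N, TangentSpace J p.2 [⋀^Fin 3]→ₗ[ℝ] ℝ) (ψ : M × N → ℝ)
    (θ : ∀ p : M × N, TangentSpace J p.2 [⋀^Fin 4]→ₗ[ℝ] ℝ)
    (hF : ∀ p, F p = fluxForm (tangentSplit I J p) (φ p) (α p) (β p) (ν p) (γ p) (δ p) (ϖ p)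
      (ε p) (ψ p) (θ p)) :
    EinsteinEquation (g₁.prod g₂) F ↔
      (∀ (p : M × N) (X Y : TangentSpace J p.2), ricci₂₂ g₁ g₂ p X Y =
        φ p ^ 2 * formNormSq (g₁.bilin p.1) (α p) / 6 * g₂.inner p.2 X Y
        + (formNormSq (g₂.bilin p.2) (ν p) / 6 * g₂.inner p.2 X Y
          - 1 / 2 * (ν p ![X] * ν p ![Y])) * formNormSq (g₁.bilin p.1) (β p)
        + (formNormSq (g₂.bilin p.2) (δ p) / 6 * g₂.inner p.2 X Y
          - 1 / 2 * formInner (g₂.bilin p.2) (interior X (δ p)) (interior Y (δ p)))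
            * formNormSq (g₁.bilin p.1) (γ p)
        + (formNormSq (g₂.bilin p.2) (ε p) / 6 * g₂.inner p.2 X Y
          - 1 / 2 * formInner (g₂.bilin p.2) (interior X (ε p)) (interior Y (ε p)))
            * formNormSq (g₁.bilin p.1) (ϖ p)
        + (formNormSq (g₂.bilin p.2) (θ p) / 6 * g₂.inner p.2 X Y
          - 1 / 2 * formInner (g₂.bilin p.2) (interior X (θ p)) (interior Y (θ p)))
            * ψ p ^ 2) ∧
      (∀ (p : M × N) (X Y : TangentSpace I p.1), ricci₁₁ g₁ g₂ p X Y =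
        (formNormSq (g₁.bilin p.1) (α p) / 6 * g₁.inner p.1 X Y
          - 1 / 2 * formInner (g₁.bilin p.1) (interior X (α p)) (interior Y (α p))) * φ p ^ 2
        + (formNormSq (g₁.bilin p.1) (β p) / 6 * g₁.inner p.1 X Y
          - 1 / 2 * formInner (g₁.bilin p.1) (interior X (β p)) (interior Y (β p)))
            * formNormSq (g₂.bilin p.2) (ν p)
        + (formNormSq (g₁.bilin p.1) (γ p) / 6 * g₁.inner p.1 X Y
          - 1 / 2 * formInner (g₁.bilin p.1) (interior X (γ p)) (interior Y (γ p)))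
            * formNormSq (g₂.bilin p.2) (δ p)
        + (formNormSq (g₁.bilin p.1) (ϖ p) / 6 * g₁.inner p.1 X Y
          - 1 / 2 * (ϖ p ![X] * ϖ p ![Y])) * formNormSq (g₂.bilin p.2) (ε p)
        + ψ p ^ 2 * formNormSq (g₂.bilin p.2) (θ p) / 6 * g₁.inner p.1 X Y) ∧
      (∀ (p : M × N) (X : TangentSpace J p.2) (Y : TangentSpace I p.1), 0 =
        φ p * ν p ![X] * formInner (g₁.bilin p.1) (β p) (interior Y (α p))
        - formInner (g₁.bilin p.1) (γ p) (interior Y (β p)) *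
          formInner (g₂.bilin p.2) (interior X (δ p)) (ν p)
        + formInner (g₁.bilin p.1) (ϖ p) (interior Y (γ p)) *
          formInner (g₂.bilin p.2) (interior X (ε p)) (δ p)
        - ψ p * ϖ p ![Y] * formInner (g₂.bilin p.2) (interior X (θ p)) (ε p)) := by
  have he := isOrthogonalSum_tangentSplit g₁ g₂
  have n := (g₁.prod g₂).bilin_nondegenerate
  have n₁ := g₁.bilin_nondegenerate
  have n₂ := g₂.bilin_nondegenerate
  have hN (p) := formNormSq_fluxForm (φ p) (α p) (β p) (ν p) (γ p) (δ p) (ϖ p) (ε p) (ψ p) (θ p)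
    (he p) (n p) (n₁ p.1) (n₂ p.2)
  have h₂₂ (p) := formInner_interior_inr_inr_fluxForm (φ p) (α p) (β p) (ν p) (γ p) (δ p) (ϖ p)
    (ε p) (ψ p) (θ p) (he p) (n p) (n₁ p.1) (n₂ p.2)
  have h₁₁ (p) := formInner_interior_inl_inl_fluxForm (φ p) (α p) (β p) (ν p) (γ p) (δ p) (ϖ p)
    (ε p) (ψ p) (θ p) (he p) (n p) (n₁ p.1) (n₂ p.2)
  have h₂₁ (p) := formInner_interior_inr_inl_fluxForm (φ p) (α p) (β p) (ν p) (γ p) (δ p) (ϖ p)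
    (ε p) (ψ p) (θ p) (he p) (n p) (n₁ p.1) (n₂ p.2)
  simp only [pureVec_tangentSplit_inl, pureVec_tangentSplit_inr, ← hF] at hN h₂₂ h₁₁ h₂₁
  constructor
  · intro hE
    refine ⟨fun p X Y => ?_, fun p X Y => ?_, fun p X Y => ?_⟩
    · rw [ricci₂₂, hE p, h₂₂, hN, Metric.prod_inner, fst_inr, fst_inr, snd_inr, snd_inr, map_zero]
      ring
    · rw [ricci₁₁, hE p, h₁₁, hN, Metric.prod_inner, fst_inl, fst_inl, snd_inl, snd_inl, map_zero]
      ring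
    · have h := hE p (tangentInr I J p X) (tangentInl I J p Y)
      rw [← ricci₂₁, ricci₂₁_eq_zero, h₂₁, hN, Metric.prod_inner, fst_inr, fst_inl, snd_inr,
        snd_inl, map_zero, map_zero] at h
      simp only [zero_apply] at h
      linarith
  · rintro ⟨hE₂, hE₁, hE⟩ p X Y
    obtain ⟨X₁, X₂, rfl⟩ := exists_eq_inl_add_inr p X
    obtain ⟨Y₁, Y₂, rfl⟩ := exists_eq_inl_add_inr p Y
    have hc := formInner_comm ((g₁.prod g₂).bilin p) ((g₁.prod g₂).symm p)
      (interior (tangentInl I J p X₁) (F p)) (interior (tangentInr I J p Y₂) (F p))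
    have e₁ := hE₁ p X₁ Y₁
    have e₂ := hE₂ p X₂ Y₂
    rw [ricci₁₁_eq] at e₁
    rw [ricci₂₂_eq] at e₂
    rw [ricci_prod, Metric.prod_inner]
    simp only [map_add, fst_inl, fst_inr, snd_inl, snd_inr, add_zero, zero_add,
      interior_add_left, formInner_add_left, formInner_add_right, hc, h₁₁, h₂₂, h₂₁, hN, ← hE, e₁,
      e₂]
    ring

end ProductEinstein

end Sugra

end

theorem mainTheorem4
    {M₁ : Type*} [TopologicalSpace M₁] [ChartedSpace (EuclideanSpace ℝ (Fin 5)) M₁]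
    [IsManifold (𝓡 5) ∞ M₁]
    {M₂ : Type*} [TopologicalSpace M₂] [ChartedSpace (EuclideanSpace ℝ (Fin 6)) M₂]
    [IsManifold (𝓡 6) ∞ M₂]
    (g₁ : Sugra.Metric (𝓡 5) M₁) (hg₁ : g₁.IsLorentzian)
    (g₂ : Sugra.Metric (𝓡 6) M₂) (hg₂ : g₂.IsNegDef)
    (φ : C^∞⟮𝓡 6, M₂; ℝ⟯) (α : Sugra.Form (𝓡 5) M₁ 4)
    (β : Sugra.Form (𝓡 5) M₁ 3) (ν : Sugra.Form (𝓡 6) M₂ 1)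
    (γ : Sugra.Form (𝓡 5) M₁ 2) (δ : Sugra.Form (𝓡 6) M₂ 2)
    (ϖ : Sugra.Form (𝓡 5) M₁ 1) (ε : Sugra.Form (𝓡 6) M₂ 3)
    (ψ : C^∞⟮𝓡 5, M₁; ℝ⟯) (θ : Sugra.Form (𝓡 6) M₂ 4) :
    -- the Ricci tensor of the product metric
    (∀ p : M₁ × M₂,
      (∀ X Y, Sugra.ricci₂₂ g₁ g₂ p X Y = g₂.ricci p.2 X Y) ∧
      (∀ X Y, Sugra.ricci₁₁ g₁ g₂ p X Y = g₁.ricci p.1 X Y) ∧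
      (∀ X Y, Sugra.ricci₂₁ g₁ g₂ p X Y = 0)) ∧
    -- the general flux form
    (Sugra.EinsteinEquation (g₁.prod g₂) (Sugra.flux φ α β ν γ δ ϖ ε ψ θ) ↔
      (∀ (p : M₁ × M₂) (X Y : TangentSpace (𝓡 6) p.2),
        Sugra.ricci₂₂ g₁ g₂ p X Y =
          φ p.2 ^ 2 * g₁.normSq α p.1 / 6 * g₂.inner p.2 X Y
          + (g₂.normSq ν p.2 / 6 * g₂.inner p.2 X Y - 1 / 2 * (ν p.2 ![X] * ν p.2 ![Y]))
            * g₁.normSq β p.1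
          + (g₂.normSq δ p.2 / 6 * g₂.inner p.2 X Y - 1 / 2 * g₂.contr δ p.2 X Y)
            * g₁.normSq γ p.1
          + (g₂.normSq ε p.2 / 6 * g₂.inner p.2 X Y - 1 / 2 * g₂.contr ε p.2 X Y)
            * g₁.normSq ϖ p.1
          + (g₂.normSq θ p.2 / 6 * g₂.inner p.2 X Y - 1 / 2 * g₂.contr θ p.2 X Y)
            * ψ p.1 ^ 2) ∧
      (∀ (p : M₁ × M₂) (X Y : TangentSpace (𝓡 5) p.1),
        Sugra.ricci₁₁ g₁ g₂ p X Y =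
          (g₁.normSq α p.1 / 6 * g₁.inner p.1 X Y - 1 / 2 * g₁.contr α p.1 X Y)
            * φ p.2 ^ 2
          + (g₁.normSq β p.1 / 6 * g₁.inner p.1 X Y - 1 / 2 * g₁.contr β p.1 X Y)
            * g₂.normSq ν p.2
          + (g₁.normSq γ p.1 / 6 * g₁.inner p.1 X Y - 1 / 2 * g₁.contr γ p.1 X Y)
            * g₂.normSq δ p.2
          + (g₁.normSq ϖ p.1 / 6 * g₁.inner p.1 X Y - 1 / 2 * (ϖ p.1 ![X] * ϖ p.1 ![Y]))
            * g₂.normSq ε p.2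
          + ψ p.1 ^ 2 * g₂.normSq θ p.2 / 6 * g₁.inner p.1 X Y) ∧
      (∀ (p : M₁ × M₂) (X : TangentSpace (𝓡 6) p.2) (Y : TangentSpace (𝓡 5) p.1),
        0 = Sugra.ricci₂₁ g₁ g₂ p X Y ∧
        Sugra.ricci₂₁ g₁ g₂ p X Y =
          1 / 2 * (φ p.2 * ν p.2 ![X] *
              Sugra.formInner (g₁.bilin p.1) (β p.1) (Sugra.interior Y (α p.1))
            - Sugra.formInner ((g₁.prod g₂).bilin p)
                (Sugra.wedge (Sugra.liftFst p (γ p.1))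
                  (Sugra.liftSnd p (Sugra.interior X (δ p.2))))
                (Sugra.wedge (Sugra.liftFst p (Sugra.interior Y (β p.1)))
                  (Sugra.liftSnd p (ν p.2)))
            + Sugra.formInner ((g₁.prod g₂).bilin p)
                (Sugra.wedge (Sugra.liftFst p (ϖ p.1))
                  (Sugra.liftSnd p (Sugra.interior X (ε p.2))))
                (Sugra.wedge (Sugra.liftFst p (Sugra.interior Y (γ p.1)))
                  (Sugra.liftSnd p (δ p.2)))
            - ψ p.1 * ϖ p.1 ![Y] *
              Sugra.formInner (g₂.bilin p.2) (Sugra.interior X (θ p.2)) (ε p.2)))) ∧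
    -- (1)
    (Sugra.EinsteinEquation (g₁.prod g₂) α.fst ↔
      (∀ (p : M₁ × M₂) (X Y : TangentSpace (𝓡 6) p.2),
        Sugra.ricci₂₂ g₁ g₂ p X Y = g₁.normSq α p.1 / 6 * g₂.inner p.2 X Y) ∧
      (∀ (p : M₁ × M₂) (X Y : TangentSpace (𝓡 5) p.1),
        Sugra.ricci₁₁ g₁ g₂ p X Y =
          g₁.normSq α p.1 / 6 * g₁.inner p.1 X Y - 1 / 2 * g₁.contr α p.1 X Y)) ∧
    -- (2)
    (Sugra.EinsteinEquation (g₁.prod g₂) (β.fst.wedge ν.snd) ↔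
      (∀ (p : M₁ × M₂) (X Y : TangentSpace (𝓡 6) p.2),
        Sugra.ricci₂₂ g₁ g₂ p X Y =
          (g₂.normSq ν p.2 / 6 * g₂.inner p.2 X Y - 1 / 2 * (ν p.2 ![X] * ν p.2 ![Y]))
            * g₁.normSq β p.1) ∧
      (∀ (p : M₁ × M₂) (X Y : TangentSpace (𝓡 5) p.1),
        Sugra.ricci₁₁ g₁ g₂ p X Y =
          (g₁.normSq β p.1 / 6 * g₁.inner p.1 X Y - 1 / 2 * g₁.contr β p.1 X Y)
            * g₂.normSq ν p.2)) ∧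
    -- (3)
    (Sugra.EinsteinEquation (g₁.prod g₂) (γ.fst.wedge δ.snd) ↔
      (∀ (p : M₁ × M₂) (X Y : TangentSpace (𝓡 6) p.2),
        Sugra.ricci₂₂ g₁ g₂ p X Y =
          (g₂.normSq δ p.2 / 6 * g₂.inner p.2 X Y - 1 / 2 * g₂.contr δ p.2 X Y)
            * g₁.normSq γ p.1) ∧
      (∀ (p : M₁ × M₂) (X Y : TangentSpace (𝓡 5) p.1),
        Sugra.ricci₁₁ g₁ g₂ p X Y =
          (g₁.normSq γ p.1 / 6 * g₁.inner p.1 X Y - 1 / 2 * g₁.contr γ p.1 X Y)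
            * g₂.normSq δ p.2)) ∧
    -- (4)
    (Sugra.EinsteinEquation (g₁.prod g₂) (ϖ.fst.wedge ε.snd) ↔
      (∀ (p : M₁ × M₂) (X Y : TangentSpace (𝓡 6) p.2),
        Sugra.ricci₂₂ g₁ g₂ p X Y =
          (g₂.normSq ε p.2 / 6 * g₂.inner p.2 X Y - 1 / 2 * g₂.contr ε p.2 X Y)
            * g₁.normSq ϖ p.1) ∧
      (∀ (p : M₁ × M₂) (X Y : TangentSpace (𝓡 5) p.1),
        Sugra.ricci₁₁ g₁ g₂ p X Y =
          (g₁.normSq ϖ p.1 / 6 * g₁.inner p.1 X Y - 1 / 2 * (ϖ p.1 ![X] * ϖ p.1 ![Y]))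
            * g₂.normSq ε p.2)) ∧
    -- (5)
    (Sugra.EinsteinEquation (g₁.prod g₂) θ.snd ↔
      (∀ (p : M₁ × M₂) (X Y : TangentSpace (𝓡 6) p.2),
        Sugra.ricci₂₂ g₁ g₂ p X Y =
          g₂.normSq θ p.2 / 6 * g₂.inner p.2 X Y - 1 / 2 * g₂.contr θ p.2 X Y) ∧
      (∀ (p : M₁ × M₂) (X Y : TangentSpace (𝓡 5) p.1),
        Sugra.ricci₁₁ g₁ g₂ p X Y = g₂.normSq θ p.2 / 6 * g₁.inner p.1 X Y)) ∧
    -- (6)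
    (Sugra.EinsteinEquation (g₁.prod g₂) (Sugra.smulSnd φ α.fst + β.fst.wedge ν.snd) ↔
      (∀ (p : M₁ × M₂) (X Y : TangentSpace (𝓡 6) p.2),
        Sugra.ricci₂₂ g₁ g₂ p X Y =
          φ p.2 ^ 2 * g₁.normSq α p.1 / 6 * g₂.inner p.2 X Y
          + (g₂.normSq ν p.2 / 6 * g₂.inner p.2 X Y - 1 / 2 * (ν p.2 ![X] * ν p.2 ![Y]))
            * g₁.normSq β p.1) ∧
      (∀ (p : M₁ × M₂) (X Y : TangentSpace (𝓡 5) p.1),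
        Sugra.ricci₁₁ g₁ g₂ p X Y =
          (g₁.normSq α p.1 / 6 * g₁.inner p.1 X Y - 1 / 2 * g₁.contr α p.1 X Y)
            * φ p.2 ^ 2
          + (g₁.normSq β p.1 / 6 * g₁.inner p.1 X Y - 1 / 2 * g₁.contr β p.1 X Y)
            * g₂.normSq ν p.2) ∧
      (∀ (p : M₁ × M₂) (X : TangentSpace (𝓡 6) p.2) (Y : TangentSpace (𝓡 5) p.1),
        0 = φ p.2 * ν p.2 ![X] *
          Sugra.formInner (g₁.bilin p.1) (β p.1) (Sugra.interior Y (α p.1)))) ∧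
    -- (7)
    (Sugra.EinsteinEquation (g₁.prod g₂) (ϖ.fst.wedge ε.snd + Sugra.smulFst ψ θ.snd) ↔
      (∀ (p : M₁ × M₂) (X Y : TangentSpace (𝓡 6) p.2),
        Sugra.ricci₂₂ g₁ g₂ p X Y =
          (g₂.normSq ε p.2 / 6 * g₂.inner p.2 X Y - 1 / 2 * g₂.contr ε p.2 X Y)
            * g₁.normSq ϖ p.1
          + (g₂.normSq θ p.2 / 6 * g₂.inner p.2 X Y - 1 / 2 * g₂.contr θ p.2 X Y)
            * ψ p.1 ^ 2) ∧
      (∀ (p : M₁ × M₂) (X Y : TangentSpace (𝓡 5) p.1),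
        Sugra.ricci₁₁ g₁ g₂ p X Y =
          (g₁.normSq ϖ p.1 / 6 * g₁.inner p.1 X Y - 1 / 2 * (ϖ p.1 ![X] * ϖ p.1 ![Y]))
            * g₂.normSq ε p.2
          + ψ p.1 ^ 2 * g₂.normSq θ p.2 / 6 * g₁.inner p.1 X Y) ∧
      (∀ (p : M₁ × M₂) (X : TangentSpace (𝓡 6) p.2) (Y : TangentSpace (𝓡 5) p.1),
        0 = ψ p.1 * ϖ p.1 ![Y] *
          Sugra.formInner (g₂.bilin p.2) (Sugra.interior X (θ p.2)) (ε p.2))) ∧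
    -- (8)
    (Sugra.EinsteinEquation (g₁.prod g₂) (α.fst + θ.snd) ↔
      (∀ (p : M₁ × M₂) (X Y : TangentSpace (𝓡 6) p.2),
        Sugra.ricci₂₂ g₁ g₂ p X Y =
          g₁.normSq α p.1 / 6 * g₂.inner p.2 X Y
          + g₂.normSq θ p.2 / 6 * g₂.inner p.2 X Y - 1 / 2 * g₂.contr θ p.2 X Y) ∧
      (∀ (p : M₁ × M₂) (X Y : TangentSpace (𝓡 5) p.1),
        Sugra.ricci₁₁ g₁ g₂ p X Y =
          g₁.normSq α p.1 / 6 * g₁.inner p.1 X Y - 1 / 2 * g₁.contr α p.1 X Y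
          + g₂.normSq θ p.2 / 6 * g₁.inner p.1 X Y)) ∧
    -- (9)
    (Sugra.EinsteinEquation (g₁.prod g₂) (β.fst.wedge ν.snd + ϖ.fst.wedge ε.snd) ↔
      (∀ (p : M₁ × M₂) (X Y : TangentSpace (𝓡 6) p.2),
        Sugra.ricci₂₂ g₁ g₂ p X Y =
          (g₂.normSq ν p.2 / 6 * g₂.inner p.2 X Y - 1 / 2 * (ν p.2 ![X] * ν p.2 ![Y]))
            * g₁.normSq β p.1
          + (g₂.normSq ε p.2 / 6 * g₂.inner p.2 X Y - 1 / 2 * g₂.contr ε p.2 X Y)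
            * g₁.normSq ϖ p.1) ∧
      (∀ (p : M₁ × M₂) (X Y : TangentSpace (𝓡 5) p.1),
        Sugra.ricci₁₁ g₁ g₂ p X Y =
          (g₁.normSq β p.1 / 6 * g₁.inner p.1 X Y - 1 / 2 * g₁.contr β p.1 X Y)
            * g₂.normSq ν p.2
          + (g₁.normSq ϖ p.1 / 6 * g₁.inner p.1 X Y - 1 / 2 * (ϖ p.1 ![X] * ϖ p.1 ![Y]))
            * g₂.normSq ε p.2)) := by
  have hr₂₁ := Sugra.ricci₂₁_eq_zero g₁ g₂
  refine ⟨fun p => ⟨Sugra.ricci₂₂_eq g₁ g₂ p, Sugra.ricci₁₁_eq g₁ g₂ p, hr₂₁ p⟩,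
    ?_, ?_, ?_, ?_, ?_, ?_, ?_, ?_, ?_, ?_⟩
  · refine (Sugra.einsteinEquation_prod_iff g₁ g₂ _ (fun p => φ p.2) (fun p => α p.1)
      (fun p => β p.1) (fun p => ν p.2) (fun p => γ p.1) (fun p => δ p.2) (fun p => ϖ p.1)
      (fun p => ε p.2) (fun p => ψ p.1) (fun p => θ p.2) fun p => rfl).trans
      (and_congr Iff.rfl (and_congr Iff.rfl (forall₃_congr fun p X Y => ?_)))
    have he := Sugra.isOrthogonalSum_tangentSplit g₁ g₂ p
    have n := (g₁.prod g₂).bilin_nondegenerate p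
    have n₁ := g₁.bilin_nondegenerate p.1
    have n₂ := g₂.bilin_nondegenerate p.2
    have w₁ : Sugra.formInner ((g₁.prod g₂).bilin p)
        (Sugra.wedge (Sugra.liftFst p (γ p.1)) (Sugra.liftSnd p (Sugra.interior X (δ p.2))))
        (Sugra.wedge (Sugra.liftFst p (Sugra.interior Y (β p.1))) (Sugra.liftSnd p (ν p.2))) =
        Sugra.formInner (g₁.bilin p.1) (γ p.1) (Sugra.interior Y (β p.1)) *
          Sugra.formInner (g₂.bilin p.2) (Sugra.interior X (δ p.2)) (ν p.2) :=
      (Sugra.isTensor_wedge (γ p.1) (Sugra.interior X (δ p.2))).formInner_eq_mul he n n₁ n₂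
        (Sugra.isTensor_wedge (Sugra.interior Y (β p.1)) (ν p.2))
    have w₂ : Sugra.formInner ((g₁.prod g₂).bilin p)
        (Sugra.wedge (Sugra.liftFst p (ϖ p.1)) (Sugra.liftSnd p (Sugra.interior X (ε p.2))))
        (Sugra.wedge (Sugra.liftFst p (Sugra.interior Y (γ p.1))) (Sugra.liftSnd p (δ p.2))) =
        Sugra.formInner (g₁.bilin p.1) (ϖ p.1) (Sugra.interior Y (γ p.1)) *
          Sugra.formInner (g₂.bilin p.2) (Sugra.interior X (ε p.2)) (δ p.2) :=
      (Sugra.isTensor_wedge (ϖ p.1) (Sugra.interior X (ε p.2))).formInner_eq_mul he n n₁ n₂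
        (Sugra.isTensor_wedge (Sugra.interior Y (γ p.1)) (δ p.2))
    -- both scalar products on the product manifold are products of scalar products on the factors
    rw [hr₂₁, w₁, w₂]
    exact ⟨fun h => ⟨rfl, by linarith⟩, fun h => by linarith [h.2]⟩
  · refine (Sugra.einsteinEquation_prod_iff g₁ g₂ _ 1 (fun p => α p.1) 0 0 0 0 0 0 0 0
      fun p => ?_).trans (and_congr (forall₃_congr fun p X Y => Eq.congr_right ?_)
      ((and_iff_left fun p X Y => ?_).trans (forall₃_congr fun p X Y => Eq.congr_right ?_)))
    · simp [Sugra.fluxForm]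
      rfl
    · simp [Sugra.Metric.normSq]
    · simp
    · simp [Sugra.Metric.normSq, Sugra.Metric.contr]
  · refine (Sugra.einsteinEquation_prod_iff g₁ g₂ _ 0 0 (fun p => β p.1) (fun p => ν p.2) 0 0 0 0
      0 0
      fun p => ?_).trans (and_congr (forall₃_congr fun p X Y => Eq.congr_right ?_)
      ((and_iff_left fun p X Y => ?_).trans (forall₃_congr fun p X Y => Eq.congr_right ?_)))
    · simp [Sugra.fluxForm]
      rfl
    · simp [Sugra.Metric.normSq]
    · simp
    · simp [Sugra.Metric.normSq, Sugra.Metric.contr]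
  · refine (Sugra.einsteinEquation_prod_iff g₁ g₂ _ 0 0 0 0 (fun p => γ p.1) (fun p => δ p.2) 0 0
      0 0
      fun p => ?_).trans (and_congr (forall₃_congr fun p X Y => Eq.congr_right ?_)
      ((and_iff_left fun p X Y => ?_).trans (forall₃_congr fun p X Y => Eq.congr_right ?_)))
    · simp [Sugra.fluxForm]
      rfl
    · simp [Sugra.Metric.normSq, Sugra.Metric.contr]
    · simp
    · simp [Sugra.Metric.normSq, Sugra.Metric.contr]
  · refine (Sugra.einsteinEquation_prod_iff g₁ g₂ _ 0 0 0 0 0 0 (fun p => ϖ p.1) (fun p => ε p.2)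
      0 0
      fun p => ?_).trans (and_congr (forall₃_congr fun p X Y => Eq.congr_right ?_)
      ((and_iff_left fun p X Y => ?_).trans (forall₃_congr fun p X Y => Eq.congr_right ?_)))
    · simp [Sugra.fluxForm]
      rfl
    · simp [Sugra.Metric.normSq, Sugra.Metric.contr]
    · simp
    · simp [Sugra.Metric.normSq]
  · refine (Sugra.einsteinEquation_prod_iff g₁ g₂ _ 0 0 0 0 0 0 0 0 1 (fun p => θ p.2)
      fun p => ?_).trans (and_congr (forall₃_congr fun p X Y => Eq.congr_right ?_)
      ((and_iff_left fun p X Y => ?_).trans (forall₃_congr fun p X Y => Eq.congr_right ?_)))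
    · simp [Sugra.fluxForm]
      rfl
    · simp [Sugra.Metric.normSq, Sugra.Metric.contr]
    · simp
    · simp [Sugra.Metric.normSq]
  · refine (Sugra.einsteinEquation_prod_iff g₁ g₂ _ (fun p => φ p.2) (fun p => α p.1)
      (fun p => β p.1) (fun p => ν p.2) 0 0 0 0 0 0
      fun p => ?_).trans (and_congr (forall₃_congr fun p X Y => Eq.congr_right ?_)
      (and_congr (forall₃_congr fun p X Y => Eq.congr_right ?_)
        (forall₃_congr fun p X Y => Eq.congr_right ?_)))
    · simp [Sugra.fluxForm]
      rfl
    · simp [Sugra.Metric.normSq]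
    · simp [Sugra.Metric.normSq, Sugra.Metric.contr]
    · simp
  · refine (Sugra.einsteinEquation_prod_iff g₁ g₂ _ 0 0 0 0 0 0 (fun p => ϖ p.1) (fun p => ε p.2)
      (fun p => ψ p.1) (fun p => θ p.2)
      fun p => ?_).trans (and_congr (forall₃_congr fun p X Y => Eq.congr_right ?_)
      (and_congr (forall₃_congr fun p X Y => Eq.congr_right ?_)
        (forall₃_congr fun p X Y => ?_)))
    · simp [Sugra.fluxForm]
      rfl
    · simp [Sugra.Metric.normSq, Sugra.Metric.contr]
    · simp [Sugra.Metric.normSq]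
    · simp
  · refine (Sugra.einsteinEquation_prod_iff g₁ g₂ _ 1 (fun p => α p.1) 0 0 0 0 0 0 1
      (fun p => θ p.2)
      fun p => ?_).trans (and_congr (forall₃_congr fun p X Y => Eq.congr_right ?_)
      ((and_iff_left fun p X Y => ?_).trans (forall₃_congr fun p X Y => Eq.congr_right ?_)))
    · simp [Sugra.fluxForm]
      rfl
    · simp [Sugra.Metric.normSq, Sugra.Metric.contr]
      ring
    · simp
    · simp [Sugra.Metric.normSq, Sugra.Metric.contr]
  · refine (Sugra.einsteinEquation_prod_iff g₁ g₂ _ 0 0 (fun p => β p.1) (fun p => ν p.2) 0 0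
      (fun p => ϖ p.1) (fun p => ε p.2) 0 0
      fun p => ?_).trans (and_congr (forall₃_congr fun p X Y => Eq.congr_right ?_)
      ((and_iff_left fun p X Y => ?_).trans (forall₃_congr fun p X Y => Eq.congr_right ?_)))
    · simp [Sugra.fluxForm]
      rfl
    · simp [Sugra.Metric.normSq, Sugra.Metric.contr]
    · simp
    · simp [Sugra.Metric.normSq, Sugra.Metric.contr]
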